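/- Let $A$ be a set and let $m_{a,b}=m_{b,a}\in\{2,3,\dots\}\cup\{\infty\}$ for $a\neq b$ in $A$. Let $P=\langle A \mid (ab)^{[m_{a,b}]}=(ba)^{[m_{a,b}]} \text{ for all } a\neq b \text{ in } A \text{ with } m_{a,b}<\infty\rangle^+$ be the corresponding Artin–Tits monoid, where $(ab)^{[m]}$ is the alternating word $abab\cdots$ of length $m$. Suppose that $P$ is irreducible, i.e. the graph on $A$ in which distinct $a,b$ are joined if and only if $m_{a,b}\neq 2$ is connected; that $P$ is not finitely generated; and that $P$ is not left reversible, i.e. $pP\cap qP=\emptyset$ for some $p,q\in P$. Let $I_l$ be the left inverse hull of the (left cancellative) monoid $P$, i.e. the smallest semigroup of partial bijections of $P$ that contains all left translations $P\to cP$, $x\mapsto cx$ $(c\in P)$, and is closed under inverses. Let $\mathcal J=\{\mathrm{dom}(s): s\in I_l\}$, a semilattice under intersection. Let $\widehat{\mathcal J}$ be the space of characters of $\mathcal J$, i.e. non-zero multiplicative maps $\chi:\mathcal J\to\{0,1\}$ with $\chi(\emptyset)=0$ if $\emptyset\in\mathcal J$, with the topology of pointwise convergence. Let $\Omega\subseteq\widehat{\mathcal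 J}$ be the subspace of those $\chi$ such that whenever $e,f_1,\dots,f_n\in\mathcal J$ satisfy $e=\bigcup_i f_i$ and $\chi(e)=1$, then $\chi(f_i)=1$ for some $i$. Let $\Omega_{\max}\subseteq\Omega$ be the set of characters $\chi$ for which $\chi^{-1}(1)$ is maximal among all characters in $\widehat{\mathcal J}$, and let $\partial\Omega=\overline{\Omega_{\max}}\subseteq\Omega$. Let $I_l\ltimes\Omega$ be the transformation groupoid with unit space $\Omega$: its elements are the classes $[s,\chi]$ with $s\in I_l$, $\chi\in\Omega$, $\chi(\mathrm{dom}(s))=1$, where $[s,\chi]=[t,\psi]$ if and only if $\chi=\psi$ and there is $e\in\mathcal J$ with $\chi(e)=1$ and $s|_e=t|_e$ (that is, $se=te$); the source of $[s,\chi]$ is $\chi$, its range is $s.\chi=\chi(s^{-1}\,\cdot\,s)$, and $[t,s.\chi][s,\chi]=[ts,\chi]$. Then $\partial\Omega=\Omega$, and the groupoid $I_l\ltimes\Omega$ is minimal, i.e. for every $\chi\in\Omega$ the orbit $\{s.\chi : s\in I_l,\ \chi(\mathrm{dom}(s))=1\}$ is dense in $\Omega$. -/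

import Mathlib

/-! ### Artin--Tits monoids -/

namespace ArtinTits

/-- The braid relations `(ab)^[m] = (ba)^[m]` with `m = m_{a,b} < ∞`. In a `CoxeterMatrix` the value
`0` encodes `m_{a,b} = ∞`, and then there is no relation. `braidWord M a b` is the alternating
word in `a` and `b` of length `m_{a,b}` that ends in `b`. -/
inductive BraidRel {A : Type*} (M : CoxeterMatrix A) : FreeMonoid A → FreeMonoid A → Prop
  | braid (a b : A) (h : M a b ≠ 0) :
      BraidRel M (FreeMonoid.ofList (CoxeterSystem.braidWord M a b))
        (FreeMonoid.ofList (CoxeterSystem.braidWord M b a))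

/-- The Artin--Tits monoid with set of atoms `A` and exponents `m_{a,b}` given by `M`. -/
abbrev ArtinTitsMonoid {A : Type*} (M : CoxeterMatrix A) : Type _ :=
  PresentedMonoid (BraidRel M)

/-- The Coxeter graph: distinct `a`, `b` are joined if `m_{a,b} ≠ 2` (so `3 ≤ m_{a,b} ≤ ∞`). -/
def coxeterGraph {A : Type*} (M : CoxeterMatrix A) : SimpleGraph A where
  Adj a b := a ≠ b ∧ M a b ≠ 2
  symm := ⟨fun a b h => ⟨h.1.symm, by rw [M.symmetric b a]; exact h.2⟩⟩
  loopless := ⟨fun _ h => h.1 rfl⟩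

/-- The Artin--Tits monoid is irreducible: its Coxeter graph is connected. -/
def IsIrreducible {A : Type*} (M : CoxeterMatrix A) : Prop :=
  (coxeterGraph M).Connected

end ArtinTits

/-- `P` is left reversible: `pP ∩ qP ≠ ∅` for all `p`, `q`. -/
def IsLeftReversible (P : Type*) [Monoid P] : Prop :=
  ∀ p q : P, (Set.range (fun x => p * x) ∩ Set.range (fun x => q * x)).Nonempty

/-! ### The left inverse hull and its characters -/

namespace InvHull

/-- Membership in the left inverse hull `I_l`: the smallest set of partial bijections of `P`
that contains every left translation `P → cP`, `x ↦ cx`, and is closed under composition and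
inverses. (`s.trans t` is `s` followed by `t`.) The notion is meant for left cancellative `P`, such
as Artin--Tits monoids: then for every `c` there is exactly one `s` as in the first clause. -/
inductive IsZigzag {P : Type*} [Monoid P] : (P ≃. P) → Prop
  | of (c : P) (s : P ≃. P) (hs : ∀ x, s x = some (c * x)) : IsZigzag s
  | symm (s : P ≃. P) : IsZigzag s → IsZigzag s.symm
  | trans (s t : P ≃. P) : IsZigzag s → IsZigzag t → IsZigzag (s.trans t)

/-- The left inverse hull `I_l` of `P`. -/
abbrev Hull (P : Type*) [Monoid P] : Type _ := {s : P ≃. P // IsZigzag s}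

/-- The domain of a partial bijection. -/
def domSet {P : Type*} (s : P ≃. P) : Set P := {x | ∃ y, s x = some y}

/-- The preimage of a set under a partial bijection. -/
def pullSet {P : Type*} (s : P ≃. P) (e : Set P) : Set P := {x | ∃ y, s x = some y ∧ y ∈ e}

theorem trans_eq_some {P : Type*} (s t : P ≃. P) (x z : P) :
    (s.trans t) x = some z ↔ ∃ y, s x = some y ∧ t y = some z :=
  PEquiv.trans_eq_some s t x z

theorem domSet_trans {P : Type*} (s t : P ≃. P) :
    domSet (s.trans t) = pullSet s (domSet t) := by
  ext x
  simp only [domSet, pullSet, Set.mem_ofPred_eq, trans_eq_some]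
  constructor
  · rintro ⟨z, y, h1, h2⟩
    exact ⟨y, h1, z, h2⟩
  · rintro ⟨y, h1, z, h2⟩
    exact ⟨z, y, h1, h2⟩

theorem pullSet_trans {P : Type*} (s t : P ≃. P) (e : Set P) :
    pullSet (s.trans t) e = pullSet s (pullSet t e) := by
  ext x
  simp only [pullSet, Set.mem_ofPred_eq, trans_eq_some]
  constructor
  · rintro ⟨z, ⟨y, h1, h2⟩, h3⟩
    exact ⟨y, h1, z, h2, h3⟩
  · rintro ⟨y, h1, z, h2, h3⟩
    exact ⟨z, ⟨y, h1, h2⟩, h3⟩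

theorem pullSet_inter {P : Type*} (s : P ≃. P) (e f : Set P) :
    pullSet s (e ∩ f) = pullSet s e ∩ pullSet s f := by
  ext x
  simp only [pullSet, Set.mem_ofPred_eq, Set.mem_inter_iff]
  constructor
  · rintro ⟨y, h1, h2, h3⟩
    exact ⟨⟨y, h1, h2⟩, ⟨y, h1, h3⟩⟩
  · rintro ⟨⟨y, h1, h2⟩, ⟨z, h3, h4⟩⟩
    rw [h1, Option.some.injEq] at h3
    subst h3
    exact ⟨y, h1, h2, h4⟩

theorem pullSet_pullSet_symm {P : Type*} (s : P ≃. P) (e : Set P) :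
    pullSet s (pullSet s.symm e) = e ∩ domSet s := by
  ext x
  simp only [pullSet, domSet, Set.mem_ofPred_eq, Set.mem_inter_iff]
  constructor
  · rintro ⟨y, h1, z, h2, h3⟩
    rw [PEquiv.eq_some_iff, ← PEquiv.eq_some_iff] at h2
    have h4 := (PEquiv.eq_some_iff s).2 h1
    rw [h4, Option.some.injEq] at h2
    subst h2
    exact ⟨h3, y, h1⟩
  · rintro ⟨h1, y, h2⟩
    exact ⟨y, h2, x, (PEquiv.eq_some_iff s).2 h2, h1⟩

theorem pullSet_domSet_symm {P : Type*} (s : P ≃. P) :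
    pullSet s (domSet s.symm) = domSet s := by
  ext x
  simp only [pullSet, domSet, Set.mem_ofPred_eq]
  constructor
  · rintro ⟨y, h1, -⟩
    exact ⟨y, h1⟩
  · rintro ⟨y, h1⟩
    exact ⟨y, h1, x, (PEquiv.eq_some_iff s).2 h1⟩

theorem isZigzag_refl (P : Type*) [Monoid P] : IsZigzag (PEquiv.refl P) :=
  IsZigzag.of 1 _ fun x => by simp

/-- The semilattice `𝒥 = {dom s : s ∈ I_l}` of constructible right ideals of `P`. -/
abbrev ConsIdeal (P : Type*) [Monoid P] : Type _ :=
  {e : Set P // ∃ s : P ≃. P, IsZigzag s ∧ e = domSet s}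

/-- The domain of `s ∈ I_l` as an element of `𝒥`. -/
def dom {P : Type*} [Monoid P] (s : Hull P) : ConsIdeal P :=
  ⟨domSet s.1, s.1, s.2, rfl⟩

/-- For `s ∈ I_l` and `e ∈ 𝒥`, the preimage of `e` under `s`, that is, `s⁻¹ e s ∈ 𝒥`. -/
def pull {P : Type*} [Monoid P] (s : Hull P) (e : ConsIdeal P) : ConsIdeal P :=
  ⟨pullSet s.1 e.1, by
    obtain ⟨t, ht, he⟩ := e.2
    exact ⟨s.1.trans t, IsZigzag.trans _ _ s.2 ht, by rw [domSet_trans, he]⟩⟩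

/-- Multiplication in `𝒥` is intersection. -/
instance (P : Type*) [Monoid P] : Mul (ConsIdeal P) where
  mul e f := ⟨e.1 ∩ f.1, by
    obtain ⟨s, hs, he⟩ := e.2
    obtain ⟨t, ht, hf⟩ := f.2
    refine ⟨(s.trans s.symm).trans t,
      IsZigzag.trans _ _ (IsZigzag.trans _ _ hs (IsZigzag.symm _ hs)) ht, ?_⟩
    rw [domSet_trans, pullSet_trans, pullSet_pullSet_symm, he, hf, Set.inter_comm]⟩

theorem coe_mul {P : Type*} [Monoid P] (e f : ConsIdeal P) : (e * f).1 = e.1 ∩ f.1 := rfl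

/-- The space of characters of `𝒥`: non-zero multiplicative maps `𝒥 → {0,1}` that send the empty
ideal, if it belongs to `𝒥`, to `0`. The topology is that of point-wise convergence. -/
abbrev Character (P : Type*) [Monoid P] : Type _ :=
  {χ : ConsIdeal P → Bool // (∃ e, χ e = true) ∧ (∀ e f, χ (e * f) = (χ e && χ f)) ∧
    ∀ e : ConsIdeal P, e.1 = ∅ → χ e = false}

/-- The subspace `Ω` of the characters `χ` such that, whenever `e = f₁ ∪ ⋯ ∪ fₙ` in `𝒥` and
`χ(e) = 1`, then `χ(fᵢ) = 1` for some `i`. -/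
abbrev Omega (P : Type*) [Monoid P] : Type _ :=
  {χ : Character P // ∀ (e : ConsIdeal P) (F : Finset (ConsIdeal P)),
    e.1 = ⋃ f ∈ F, f.1 → χ.1 e = true → ∃ f ∈ F, χ.1 f = true}

/-- `χ⁻¹(1)` is maximal among all characters of `𝒥`. -/
def IsMaxCharacter {P : Type*} [Monoid P] (χ : Character P) : Prop :=
  ∀ ψ : Character P, {e | χ.1 e = true} ⊆ {e | ψ.1 e = true} → ψ = χ

/-- The boundary `∂Ω`: the closure in `Ω` of the set of maximal characters. -/
def boundary (P : Type*) [Monoid P] : Set (Omega P) :=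
  closure {χ : Omega P | IsMaxCharacter χ.1}

/-! ### The transformation groupoid -/

/-- The action of `I_l` on `Ω`: for `χ(dom s) = 1`, the character `s.χ = χ(s⁻¹ ⬝ s)`. -/
def act {P : Type*} [Monoid P] (s : Hull P) (χ : Omega P) (h : χ.1.1 (dom s) = true) :
    Omega P :=
  ⟨⟨fun e => χ.1.1 (pull s e), by
    obtain ⟨_, hmul, hzero⟩ := χ.1.2
    refine ⟨⟨dom ⟨s.1.symm, IsZigzag.symm _ s.2⟩, ?_⟩, fun e f => ?_, fun e he => ?_⟩
    · have : pull s (dom ⟨s.1.symm, IsZigzag.symm _ s.2⟩) = dom s :=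
        Subtype.ext (pullSet_domSet_symm s.1)
      exact (congrArg χ.1.1 this).trans h
    · have : pull s (e * f) = pull s e * pull s f := Subtype.ext (pullSet_inter s.1 e.1 f.1)
      exact (congrArg χ.1.1 this).trans (hmul _ _)
    · refine hzero _ ?_
      simp [pull, pullSet, he]⟩, by
    classical
    intro e F he h1
    obtain ⟨f, hf, h2⟩ := χ.2 (pull s e) (F.image (pull s)) (by
      ext x
      simp only [pull, pullSet, he, Set.mem_iUnion, Set.mem_ofPred_eq, exists_prop]
      constructor
      · rintro ⟨y, hy, f, hf, hyf⟩
        exact ⟨pull s f, Finset.mem_image_of_mem _ hf, y, hy, hyf⟩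
      · rintro ⟨g, hg, hx⟩
        obtain ⟨f, hf, rfl⟩ := Finset.mem_image.1 hg
        obtain ⟨y, hy, hyf⟩ := hx
        exact ⟨y, hy, f, hf, hyf⟩) h1
    obtain ⟨g, hg, rfl⟩ := Finset.mem_image.1 hf
    exact ⟨g, hg, h2⟩⟩

/-- The pairs `(s, χ)` with `s ∈ I_l`, `χ(dom s) = 1` and `s.χ = ψ`, for fixed `χ`, `ψ ∈ Ω`. -/
abbrev PreArrow {P : Type*} [Monoid P] (χ ψ : Omega P) : Type _ :=
  {s : Hull P // ∃ h : χ.1.1 (dom s) = true, act s χ h = ψ}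

/-- `(s, χ) ∼ (t, χ)` if there is `e ∈ 𝒥` with `χ(e) = 1` on which `s` and `t` agree,
that is, `se = te`. -/
instance arrowSetoid {P : Type*} [Monoid P] (χ ψ : Omega P) : Setoid (PreArrow χ ψ) where
  r s t := ∃ e : ConsIdeal P, χ.1.1 e = true ∧ ∀ x ∈ e.1, s.1.1 x = t.1.1 x
  iseqv := by
    refine ⟨fun s => ?_, ?_, ?_⟩
    · obtain ⟨e, he⟩ := χ.1.2.1
      exact ⟨e, he, fun _ _ => rfl⟩
    · rintro s t ⟨e, he, h⟩
      exact ⟨e, he, fun x hx => (h x hx).symm⟩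
    · rintro s t u ⟨e, he, h⟩ ⟨f, hf, h'⟩
      refine ⟨e * f, by rw [χ.1.2.2.1, he, hf]; rfl, fun x hx => ?_⟩
      exact (h x hx.1).trans (h' x hx.2)

/-- The arrows `[s, χ]` of `I_l ⋉ Ω` with source `χ` and range `s.χ = ψ`. -/
abbrev Arrow {P : Type*} [Monoid P] (χ ψ : Omega P) : Type _ :=
  Quotient (arrowSetoid χ ψ)

/-- The pair `(1, χ)`. -/
def PreArrow.one {P : Type*} [Monoid P] (χ : Omega P) : PreArrow χ χ :=
  ⟨⟨PEquiv.refl P, isZigzag_refl P⟩, by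
    have key : ∀ e : ConsIdeal P, pull ⟨PEquiv.refl P, isZigzag_refl P⟩ e = e := by
      intro e
      apply Subtype.ext
      ext x
      simp [pull, pullSet]
    obtain ⟨e, he⟩ := χ.1.2.1
    have hd : dom ⟨PEquiv.refl P, isZigzag_refl P⟩ * e = e := by
      apply Subtype.ext
      rw [coe_mul]
      ext x
      simp [dom, domSet]
    refine ⟨?_, ?_⟩
    · rw [← hd, χ.1.2.2.1, Bool.and_eq_true] at he
      exact he.1
    · apply Subtype.ext
      apply Subtype.ext
      funext f
      exact congrArg χ.1.1 (key f)⟩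

/-- The product `(t, s.χ)(s, χ) = (ts, χ)`. -/
def PreArrow.comp {P : Type*} [Monoid P] {χ ψ ω : Omega P}
    (s : PreArrow χ ψ) (t : PreArrow ψ ω) : PreArrow χ ω :=
  ⟨⟨s.1.1.trans t.1.1, IsZigzag.trans _ _ s.1.2 t.1.2⟩, by
    obtain ⟨s, hs, rfl⟩ := s
    obtain ⟨t, ht, rfl⟩ := t
    refine ⟨?_, ?_⟩
    · have : dom ⟨s.1.trans t.1, IsZigzag.trans _ _ s.2 t.2⟩ = pull s (dom t) :=
        Subtype.ext (domSet_trans s.1 t.1)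
      rw [this]
      exact ht
    · apply Subtype.ext
      apply Subtype.ext
      funext f
      exact congrArg χ.1.1 (Subtype.ext (pullSet_trans s.1 t.1 f.1))⟩

/-- The inverse `(s, χ)⁻¹ = (s⁻¹, s.χ)`. -/
def PreArrow.inv {P : Type*} [Monoid P] {χ ψ : Omega P} (s : PreArrow χ ψ) : PreArrow ψ χ :=
  ⟨⟨s.1.1.symm, IsZigzag.symm _ s.1.2⟩, by
    obtain ⟨s, hs, rfl⟩ := s
    refine ⟨?_, ?_⟩
    · have : pull s (dom ⟨s.1.symm, IsZigzag.symm _ s.2⟩) = dom s :=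
        Subtype.ext (pullSet_domSet_symm s.1)
      change χ.1.1 (pull s (dom ⟨s.1.symm, IsZigzag.symm _ s.2⟩)) = true
      rw [this, hs]
    · apply Subtype.ext
      apply Subtype.ext
      funext f
      change χ.1.1 (pull s (pull ⟨s.1.symm, IsZigzag.symm _ s.2⟩ f)) = χ.1.1 f
      have : pull s (pull ⟨s.1.symm, IsZigzag.symm _ s.2⟩ f) = f * dom s :=
        Subtype.ext (pullSet_pullSet_symm s.1 f.1)
      rw [this, χ.1.2.2.1, hs, Bool.and_true]⟩

/-- The product `[t, s.χ][s, χ] = [ts, χ]`, written in the order of composition of arrows. -/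
def Arrow.comp {P : Type*} [Monoid P] {χ ψ ω : Omega P} :
    Arrow χ ψ → Arrow ψ ω → Arrow χ ω :=
  Quotient.map₂ PreArrow.comp (by
    rintro s s' ⟨e, he, h⟩ t t' ⟨f, hf, h'⟩
    obtain ⟨hs, hsψ⟩ := s.2
    refine ⟨e * pull s.1 f, ?_, ?_⟩
    · rw [← hsψ] at hf
      rw [χ.1.2.2.1, he, Bool.true_and]
      exact hf
    · rintro x ⟨hx, y, hy, hyf⟩
      change (s.1.1 x).bind t.1.1 = (s'.1.1 x).bind t'.1.1
      rw [← h x hx, hy]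
      exact h' y hyf)

/-- The inverse `[s, χ]⁻¹ = [s⁻¹, s.χ]`. -/
def Arrow.inv {P : Type*} [Monoid P] {χ ψ : Omega P} : Arrow χ ψ → Arrow ψ χ :=
  Quotient.map PreArrow.inv (by
    rintro s t ⟨e, he, h⟩
    obtain ⟨hs, hsψ⟩ := s.2
    refine ⟨pull ⟨s.1.1.symm, IsZigzag.symm _ s.1.2⟩ e, ?_, ?_⟩
    · refine (congrArg (fun w : Omega P => w.1.1
        (pull ⟨s.1.1.symm, IsZigzag.symm _ s.1.2⟩ e)) hsψ).symm.trans ?_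
      change χ.1.1 (pull s.1 (pull ⟨s.1.1.symm, IsZigzag.symm _ s.1.2⟩ e)) = true
      have : pull s.1 (pull ⟨s.1.1.symm, IsZigzag.symm _ s.1.2⟩ e) = e * dom s.1 :=
        Subtype.ext (pullSet_pullSet_symm s.1.1 e.1)
      rw [this, χ.1.2.2.1, hs, he]
      rfl
    · rintro y ⟨x, hx, hxe⟩
      change s.1.1.symm y = t.1.1.symm y
      have h1 : s.1.1 x = some y := (PEquiv.eq_some_iff s.1.1).1 hx
      rw [h x hxe] at h1
      exact hx.trans ((PEquiv.eq_some_iff t.1.1).2 h1).symm)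

/-- The transformation groupoid `I_l ⋉ Ω`, with unit space `Ω`. -/
instance transformationGroupoid (P : Type*) [Monoid P] : CategoryTheory.Groupoid (Omega P) where
  Hom χ ψ := Arrow χ ψ
  id χ := Quotient.mk _ (PreArrow.one χ)
  comp f g := Arrow.comp f g
  inv f := Arrow.inv f
  id_comp {χ ψ} f := by
    induction f using Quotient.inductionOn with | _ s => ?_
    obtain ⟨e, he⟩ := χ.1.2.1
    exact Quotient.sound ⟨e, he, fun x _ => rfl⟩
  comp_id {χ ψ} f := by
    induction f using Quotient.inductionOn with | _ s => ?_
    obtain ⟨e, he⟩ := χ.1.2.1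
    refine Quotient.sound ⟨e, he, fun x _ => ?_⟩
    change (s.1.1.trans (PEquiv.refl P)) x = s.1.1 x
    rw [PEquiv.trans_refl]
  assoc {χ ψ ω υ} f g h := by
    induction f using Quotient.inductionOn with | _ s => ?_
    induction g using Quotient.inductionOn with | _ t => ?_
    induction h using Quotient.inductionOn with | _ u => ?_
    obtain ⟨e, he⟩ := χ.1.2.1
    refine Quotient.sound ⟨e, he, fun x _ => ?_⟩
    change ((s.1.1.trans t.1.1).trans u.1.1) x = (s.1.1.trans (t.1.1.trans u.1.1)) x
    rw [PEquiv.trans_assoc]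
  inv_comp {χ ψ} f := by
    induction f using Quotient.inductionOn with | _ s => ?_
    obtain ⟨hd, -⟩ := (PreArrow.inv s).2
    refine Quotient.sound ⟨_, hd, ?_⟩
    rintro y ⟨x, hx⟩
    change (s.1.1.symm.trans s.1.1) y = some y
    exact (trans_eq_some _ _ _ _).2 ⟨x, hx, (PEquiv.eq_some_iff s.1.1).1 hx⟩
  comp_inv {χ ψ} f := by
    induction f using Quotient.inductionOn with | _ s => ?_
    obtain ⟨hd, -⟩ := s.2
    refine Quotient.sound ⟨_, hd, ?_⟩
    rintro x ⟨y, hy⟩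
    change (s.1.1.trans s.1.1.symm) x = some x
    exact (trans_eq_some _ _ _ _).2 ⟨y, hy, (PEquiv.eq_some_iff s.1.1).2 hy⟩

end InvHull

/-- A groupoid with topologised unit space `X` is minimal if every orbit
`{r(γ) : s(γ) = x}` is dense in `X`. -/
def IsMinimalGroupoid (X : Type*) [TopologicalSpace X] [CategoryTheory.Groupoid X] : Prop :=
  ∀ x : X, Dense {y : X | Nonempty (x ⟶ y)}

/-!
The argument has two halves: a divisibility theory for Artin--Tits monoids, and the construction of
elements that are incompatible with any prescribed finite set of atoms.

*Reduction to atoms.* In a left cancellative monoid with least common right multiples every non-empty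
constructible ideal is principal, so every character lies in `Ω`. A basic open set of `Ω` around `χ`
prescribes `χ(qP) = 1` and finitely many conditions `χ(qrP) = 0` with `r ≠ 1`. If some `x` has no
common right multiple with any of these `r`, then all characters with value `1` at `qxP` lie in the
open set (`InvHull.exists_forall_mem_of_map_principal`). Some of them are maximal, by Zorn's lemma, and
the left translation by `qx` moves any given character to one of them. So both claims follow once `x`
is found, and there `r` may be replaced by an atom that divides it.

*Divisibility.* Write `W` for the Coxeter group of `M`. Tits' positivity theorem for the contragredient
geometric representation (`ArtinTits.geomRep_pos`) shows that an element of `W` with left descents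
`s ≠ t` has the longest element of the (then finite) dihedral group of `s` and `t` as a prefix. This
yields Matsumoto's theorem, hence a lift of `W` to the monoid, and, by Newman's argument, for
`u, w ∈ W` the largest prefix `v` of `w` with `u * v` reduced. These prefixes define an action of the
monoid on pairs `(w, q)`, which computes a greedy factorization of every element
(`ArtinTits.greedyHom`). Left cancellation and the lcm of two atoms (`ArtinTits.compl_dvd`) are read off
from this action, and least common multiples in general (`ArtinTits.exists_isLcm`) follow by induction
on the length.

*Avoiding atoms.* Since the monoid is not left reversible, some `z` has no common multiple with some
atom `g`. A product `b * b * x` with `x` not `Blocked` at `b` is divisible only by `b` and by atoms that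
divide `x` and commute with `b`. As there are infinitely many atoms, a letter `d` not occurring in `z`
exists; `z` is not blocked at `d`, and multiplying by doubled letters along the connected Coxeter graph
unblocks any finite set of letters, while the rule `ArtinTits.Avoids.swap` carries the avoided letter
along (`ArtinTits.Movable`). A doubled walk that starts outside a finite set `T` and passes neighbours
of all letters of `T`, followed by an element unblocked at the letters of the walk, is divisible by no
atom of `T`, and that element can be chosen so that the product avoids any given letter
(`ArtinTits.exists_avoids_not_dvd`). Appending such elements one after the other gives an element that
avoids finitely many letters simultaneously (`ArtinTits.exists_forall_avoids`).
-/

namespace ArtinTits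

/-! ### Alternating products -/

/-- The alternating product `x * y * x * ⋯` with `n` factors, starting with `x`. -/
def altProd {G : Type*} [Monoid G] (x y : G) : ℕ → G
  | 0 => 1
  | n + 1 => x * altProd y x n

theorem altProd_zero {G : Type*} [Monoid G] (x y : G) : altProd x y 0 = 1 := rfl

theorem altProd_succ {G : Type*} [Monoid G] (x y : G) (n : ℕ) :
    altProd x y (n + 1) = x * altProd y x n := rfl

theorem altProd_add {G : Type*} [Monoid G] (x y : G) (n k : ℕ) :
    altProd x y (n + k) = altProd x y n * altProd (if Even n then x else y)
      (if Even n then y else x) k := by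
  induction n generalizing x y with
  | zero => simp [altProd_zero]
  | succ n ih =>
    rw [Nat.succ_add, altProd_succ, ih, altProd_succ, mul_assoc]
    by_cases h : Even n <;> simp [h, Nat.even_add_one]

theorem altProd_succ_right {G : Type*} [Monoid G] (x y : G) (n : ℕ) :
    altProd x y (n + 1) = altProd x y n * (if Even n then x else y) := by
  rw [altProd_add, altProd_succ, altProd_zero, mul_one]

theorem map_altProd {G H F : Type*} [Monoid G] [Monoid H] [FunLike F G H] [MonoidHomClass F G H]
    (φ : F) (x y : G) (n : ℕ) : φ (altProd x y n) = altProd (φ x) (φ y) n := by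
  induction n generalizing x y with
  | zero => simp [altProd_zero]
  | succ n ih => rw [altProd_succ, map_mul, ih, altProd_succ]

theorem altProd_two_mul {G : Type*} [Monoid G] (x y : G) (n : ℕ) :
    altProd x y (2 * n) = (x * y) ^ n := by
  induction n with
  | zero => simp [altProd_zero]
  | succ n ih => rw [Nat.mul_succ, altProd_succ, altProd_succ, ih, pow_succ', mul_assoc]

/-! ### The contragredient geometric representation of a Coxeter group -/

variable {A : Type*}

/-- The coefficients `2 cos (π / m_{s,t})` of the geometric representation, with the value `2` when
`m_{s,t} = ∞`. Since `m_{s,s} = 1`, the value at `(s, s)` is `-2`. -/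
noncomputable def geomCoeff (M : CoxeterMatrix A) (s t : A) : ℝ :=
  if M s t = 0 then 2 else 2 * Real.cos (Real.pi / M s t)

theorem geomCoeff_self (M : CoxeterMatrix A) (s : A) : geomCoeff M s s = -2 := by
  simp [geomCoeff]

theorem geomCoeff_symm (M : CoxeterMatrix A) (s t : A) : geomCoeff M s t = geomCoeff M t s := by
  simp [geomCoeff, M.symmetric s t]

/-- The simple reflection attached to `s`, on the space of all real functions on `A`. All functions are
allowed, so that for infinite `A` the constant function `1` lies in the open fundamental chamber. -/
noncomputable def geomRefl (M : CoxeterMatrix A) (s : A) : Function.End (A → ℝ) :=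
  fun f t => f t + geomCoeff M s t * f s

theorem geomRefl_apply (M : CoxeterMatrix A) (s t : A) (f : A → ℝ) :
    geomRefl M s f t = f t + geomCoeff M s t * f s := rfl

theorem geomRefl_apply_self (M : CoxeterMatrix A) (s : A) (f : A → ℝ) :
    geomRefl M s f s = - f s := by
  rw [geomRefl_apply, geomCoeff_self]; ring

theorem geomRefl_geomRefl (M : CoxeterMatrix A) (s : A) (f : A → ℝ) :
    geomRefl M s (geomRefl M s f) = f := by
  funext t
  rw [geomRefl_apply, geomRefl_apply_self, geomRefl_apply]
  ring

/-- The Chebyshev-like sequence `sin (n θ) / sin θ` for `c = 2 cos θ`, given by its recursion. -/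
noncomputable def chebSeq (c : ℝ) : ℕ → ℝ
  | 0 => 0
  | 1 => 1
  | n + 2 => c * chebSeq c (n + 1) - chebSeq c n

theorem chebSeq_mul_sin (θ : ℝ) (n : ℕ) :
    chebSeq (2 * Real.cos θ) n * Real.sin θ = Real.sin (n * θ) := by
  induction n using Nat.twoStepInduction with
  | zero => simp [chebSeq]
  | one => simp [chebSeq]
  | more n h0 h1 =>
    rw [chebSeq, sub_mul, h0, mul_assoc, h1]
    push_cast
    have e1 : ((n : ℝ) + 2) * θ = ((n : ℝ) + 1) * θ + θ := by ring
    have e2 : (n : ℝ) * θ = ((n : ℝ) + 1) * θ - θ := by ring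
    rw [e1, e2, Real.sin_add, Real.sin_sub]
    ring

theorem chebSeq_two (n : ℕ) : chebSeq 2 n = n := by
  induction n using Nat.twoStepInduction with
  | zero => simp [chebSeq]
  | one => simp [chebSeq]
  | more n h0 h1 =>
    rw [chebSeq, h0, h1]
    push_cast
    ring

/-- An alternating product of two reflections, evaluated at the letter that would come next. -/
theorem altProd_geomRefl_apply (M : CoxeterMatrix A) (p q : A) (n : ℕ) (g : A → ℝ) :
    altProd (geomRefl M q) (geomRefl M p) n g p =
      if Even n then chebSeq (geomCoeff M p q) (n + 1) * g p + chebSeq (geomCoeff M p q) n * g q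
      else chebSeq (geomCoeff M p q) n * g p + chebSeq (geomCoeff M p q) (n + 1) * g q := by
  induction n using Nat.twoStepInduction generalizing p q with
  | zero => simp [altProd_zero, chebSeq, Function.End.one_def]
  | one =>
    have h : altProd (geomRefl M q) (geomRefl M p) 1 g p = geomRefl M q g p := rfl
    rw [h, geomRefl_apply, geomCoeff_symm M q p]
    simp [chebSeq]
  | more n h0 h1 =>
    have e : altProd (geomRefl M q) (geomRefl M p) (n + 2) g p =
        - (altProd (geomRefl M q) (geomRefl M p) n g p) + geomCoeff M p q *
          altProd (geomRefl M p) (geomRefl M q) (n + 1) g q := by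
      have : altProd (geomRefl M q) (geomRefl M p) (n + 2) g p =
        geomRefl M q (geomRefl M p (altProd (geomRefl M q) (geomRefl M p) n g)) p := rfl
      rw [this, geomRefl_apply, geomRefl_apply_self, geomCoeff_symm M q p]
      rfl
    rw [e, h0, h1, geomCoeff_symm M q p]
    have r1 : chebSeq (geomCoeff M p q) (n + 2) = geomCoeff M p q *
      chebSeq (geomCoeff M p q) (n + 1) - chebSeq (geomCoeff M p q) n := rfl
    have r2 : chebSeq (geomCoeff M p q) (n + 2 + 1) = geomCoeff M p q *
      chebSeq (geomCoeff M p q) (n + 2) - chebSeq (geomCoeff M p q) (n + 1) := rfl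
    by_cases hn : Even n
    · simp only [hn, Nat.even_add_one, not_true_eq_false, not_false_eq_true, if_true, if_false]
      rw [r2, r1]; ring
    · simp only [hn, Nat.even_add_one, not_true_eq_false, not_false_eq_true, if_true, if_false]
      rw [r2, r1]; ring

/-- Both reflections change a function only by multiples of the rows of `s` and `t`. -/
theorem altProd_geomRefl_sub_mem_span (M : CoxeterMatrix A) (s t : A) (n : ℕ) (f : A → ℝ) :
    ∃ x y : ℝ, ∀ r, altProd (geomRefl M s) (geomRefl M t) n f r =
      f r + x * geomCoeff M s r + y * geomCoeff M t r := by
  induction n generalizing s t with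
  | zero => exact ⟨0, 0, fun r => by simp [altProd_zero, Function.End.one_def]⟩
  | succ n ih =>
    obtain ⟨x, y, h⟩ := ih t s
    refine ⟨y + altProd (geomRefl M t) (geomRefl M s) n f s, x, fun r => ?_⟩
    have : altProd (geomRefl M s) (geomRefl M t) (n + 1) f r =
      geomRefl M s (altProd (geomRefl M t) (geomRefl M s) n f) r := rfl
    rw [this, geomRefl_apply, h r]
    ring

theorem two_le_of_ne (M : CoxeterMatrix A) {s t : A} (hst : s ≠ t) (h0 : M s t ≠ 0) :
    2 ≤ M s t := by
  have := M.off_diagonal s t hst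
  omega

theorem sin_pi_div_pos {m : ℕ} (hm : 2 ≤ m) : 0 < Real.sin (Real.pi / m) := by
  have hm' : (2 : ℝ) ≤ m := by exact_mod_cast hm
  apply Real.sin_pos_of_pos_of_lt_pi
  · positivity
  · exact div_lt_self Real.pi_pos (by linarith)

/-- The reflections satisfy the Coxeter relations: the word of length `2 * m_{s,t}` changes a function
by a combination of the rows of `s` and `t` that vanishes at `s` and `t`, and the Gram matrix of these
rows is nonsingular for `m_{s,t} < ∞`. -/
theorem isLiftable_geomRefl (M : CoxeterMatrix A) : M.IsLiftable (geomRefl M) := by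
  intro s t
  by_cases hst : s = t
  · subst hst
    rw [M.diagonal, pow_one]
    funext f
    exact geomRefl_geomRefl M s f
  by_cases h0 : M s t = 0
  · rw [h0, pow_zero]
  have hm := two_le_of_ne M hst h0
  set m := M s t with hmdef
  have hsin := sin_pi_div_pos hm
  have hc : geomCoeff M s t = 2 * Real.cos (Real.pi / m) := by simp [geomCoeff, ← hmdef, h0]
  have hm0 : (m : ℝ) ≠ 0 := by exact_mod_cast h0
  have cheb : ∀ n : ℕ, chebSeq (geomCoeff M s t) n =
      Real.sin (n * (Real.pi / m)) / Real.sin (Real.pi / m) := fun n => by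
    rw [eq_div_iff hsin.ne', hc, chebSeq_mul_sin]
  have e2 : (2 * (m : ℝ)) * (Real.pi / m) = 2 * Real.pi := by field_simp
  have c0 : chebSeq (geomCoeff M s t) (2 * m) = 0 := by
    rw [cheb]; push_cast; rw [e2]; simp
  have c1 : chebSeq (geomCoeff M s t) (2 * m + 1) = 1 := by
    rw [cheb]; push_cast; rw [add_mul, e2, one_mul, add_comm, Real.sin_add_two_pi]
    exact div_self hsin.ne'
  have c2 : chebSeq (geomCoeff M s t) (2 * m - 1) = -1 := by
    rw [cheb, Nat.cast_sub (by omega)]; push_cast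
    rw [sub_mul, e2, one_mul, Real.sin_two_pi_sub, neg_div, div_self hsin.ne']
  rw [← altProd_two_mul]
  funext f
  -- Both coordinates that the two reflections see return to their initial values.
  have ht : altProd (geomRefl M s) (geomRefl M t) (2 * m) f t = f t := by
    rw [altProd_geomRefl_apply, geomCoeff_symm M t s, c0, c1]; simp
  have hs : altProd (geomRefl M s) (geomRefl M t) (2 * m) f s = f s := by
    obtain ⟨k, hk⟩ : ∃ k, 2 * m = k + 1 := ⟨2 * m - 1, by omega⟩
    have hodd : ¬ Even k := by
      intro h; have := h.add_one; rw [← hk] at this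
      exact (Nat.not_even_iff_odd.2 this) (even_two_mul m)
    have hk' : k = 2 * m - 1 := by omega
    have : altProd (geomRefl M s) (geomRefl M t) (2 * m) f s =
      geomRefl M s (altProd (geomRefl M t) (geomRefl M s) k f) s := by rw [hk]; rfl
    rw [this, geomRefl_apply_self, altProd_geomRefl_apply, if_neg hodd, ← hk, c0, hk', c2]
    ring
  obtain ⟨x, y, h⟩ := altProd_geomRefl_sub_mem_span M s t (2 * m) f
  have h1 := h s
  have h2 := h t
  rw [hs, geomCoeff_self, geomCoeff_symm M t s, hc] at h1
  rw [ht, geomCoeff_self, hc] at h2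
  set u := Real.cos (Real.pi / m)
  have hu : u ^ 2 = 1 - Real.sin (Real.pi / m) ^ 2 := by
    have := Real.sin_sq_add_cos_sq (Real.pi / m); linarith
  have hpos : 0 < Real.sin (Real.pi / m) ^ 2 := by positivity
  have hx : x = y * u := by linarith
  have hy : y = x * u := by linarith
  have hx0 : x = 0 := by
    have : x * (1 - u ^ 2) = 0 := by
      have : x = x * u * u := by rw [← hy]; exact hx
      linear_combination this
    rcases mul_eq_zero.1 this with h' | h'
    · exact h'
    · rw [hu] at h'; linarith
  have hy0 : y = 0 := by rw [hy, hx0, zero_mul]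
  funext r
  rw [h r, hx0, hy0]
  simp [Function.End.one_def]

/-- The rank two case of Tits' positivity theorem: if `g` is positive at `p` and `q`, then after an
alternating word shorter than `m_{p,q}` it is still positive at the letter that would come next. -/
theorem altProd_geomRefl_pos (M : CoxeterMatrix A) {p q : A} (hpq : p ≠ q) {n : ℕ}
    (hn : M p q = 0 ∨ n < M p q) {g : A → ℝ} (hp : 0 < g p) (hq : 0 < g q) :
    0 < altProd (geomRefl M q) (geomRefl M p) n g p := by
  have key : 0 ≤ chebSeq (geomCoeff M p q) n ∧ 0 ≤ chebSeq (geomCoeff M p q) (n + 1) ∧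
      0 < chebSeq (geomCoeff M p q) n + chebSeq (geomCoeff M p q) (n + 1) := by
    by_cases h0 : M p q = 0
    · have hc : geomCoeff M p q = 2 := by simp [geomCoeff, h0]
      rw [hc, chebSeq_two, chebSeq_two]
      push_cast
      exact ⟨by positivity, by positivity, by positivity⟩
    · have hn : n < M p q := hn.resolve_left h0
      have hm := two_le_of_ne M hpq h0
      set m := M p q with hmdef
      have hsin := sin_pi_div_pos hm
      have hc : geomCoeff M p q = 2 * Real.cos (Real.pi / m) := by simp [geomCoeff, ← hmdef, h0]
      have cheb : ∀ n : ℕ, chebSeq (geomCoeff M p q) n =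
          Real.sin (n * (Real.pi / m)) / Real.sin (Real.pi / m) := fun n => by
        rw [eq_div_iff hsin.ne', hc, chebSeq_mul_sin]
      have hm0 : (0 : ℝ) < m := by exact_mod_cast (by omega : 0 < m)
      have bound : ∀ k : ℕ, k ≤ m → (k : ℝ) * (Real.pi / m) ≤ Real.pi := fun k hk => by
        have : (k : ℝ) ≤ m := by exact_mod_cast hk
        calc (k : ℝ) * (Real.pi / m) ≤ m * (Real.pi / m) := by
              have := Real.pi_pos; gcongr
          _ = Real.pi := by field_simp
      have nonneg : ∀ k : ℕ, k ≤ m → 0 ≤ chebSeq (geomCoeff M p q) k := fun k hk => by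
        rw [cheb]
        exact div_nonneg (Real.sin_nonneg_of_nonneg_of_le_pi
          (by have := Real.pi_pos; positivity) (bound k hk)) hsin.le
      refine ⟨nonneg n hn.le, nonneg (n + 1) hn, ?_⟩
      rcases Nat.eq_zero_or_pos n with rfl | hn0
      · simp [chebSeq]
      · have : 0 < chebSeq (geomCoeff M p q) n := by
          rw [cheb]
          refine div_pos (Real.sin_pos_of_pos_of_lt_pi ?_ ?_) hsin
          · have := Real.pi_pos
            have : (0 : ℝ) < n := by exact_mod_cast hn0
            positivity
          · have h1 : (n : ℝ) < m := by exact_mod_cast hn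
            calc (n : ℝ) * (Real.pi / m) < m * (Real.pi / m) := by
                  have := Real.pi_pos; gcongr
              _ = Real.pi := by field_simp
        have := nonneg (n + 1) hn
        linarith
  obtain ⟨h1, h2, h3⟩ := key
  have pos : ∀ u v x y : ℝ, 0 ≤ u → 0 ≤ v → 0 < u + v → 0 < x → 0 < y → 0 < u * x + v * y := by
    intro u v x y hu hv huv hx hy
    rcases hu.eq_or_lt with rfl | hu
    · have : 0 < v := by linarith
      positivity
    · positivity
  rw [altProd_geomRefl_apply]
  split_ifs
  · exact pos _ _ _ _ h2 h1 (by linarith) hp hq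
  · exact pos _ _ _ _ h1 h2 h3 hp hq

/-! ### Descents and dihedral subgroups of a Coxeter group -/

open CoxeterSystem in
theorem prod_map_alternatingWord {G : Type*} [Monoid G] (f : A → G) (a b : A) (n : ℕ) :
    ((alternatingWord a b n).map f).prod =
      if Even n then altProd (f a) (f b) n else altProd (f b) (f a) n := by
  induction n with
  | zero => simp [altProd_zero, alternatingWord]
  | succ n ih =>
    rw [alternatingWord_succ', List.map_cons, List.prod_cons, ih]
    by_cases h : Even n <;> simp [h, Nat.even_add_one, altProd_succ]

section

variable {M : CoxeterMatrix A} {W : Type*} [Group W] (cs : CoxeterSystem M W)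

theorem altProd_simple_comm (a b : A) :
    altProd (cs.simple a) (cs.simple b) (M a b) = altProd (cs.simple b) (cs.simple a) (M a b) := by
  have h := cs.wordProd_braidWord_eq a b
  rw [CoxeterSystem.wordProd, CoxeterSystem.wordProd, CoxeterSystem.braidWord,
    CoxeterSystem.braidWord, prod_map_alternatingWord, prod_map_alternatingWord,
    M.symmetric b a] at h
  split_ifs at h
  · exact h
  · exact h.symm

theorem altProd_simple_inv (a b : A) (n : ℕ) :
    (altProd (cs.simple a) (cs.simple b) n)⁻¹ =
      if Even n then altProd (cs.simple b) (cs.simple a) n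
      else altProd (cs.simple a) (cs.simple b) n := by
  induction n generalizing a b with
  | zero => simp [altProd_zero]
  | succ n ih =>
    rw [altProd_succ, mul_inv_rev, ih, cs.inv_simple]
    by_cases h : Even n
    · simp only [h, Nat.even_add_one, if_true, not_true_eq_false, if_false]
      rw [← altProd_succ, altProd_succ_right, if_pos h]
    · simp only [h, Nat.even_add_one, if_false, not_false_eq_true, if_true]
      rw [altProd_succ_right, if_neg h]

theorem length_altProd_le (a b : A) (n : ℕ) :
    cs.length (altProd (cs.simple a) (cs.simple b) n) ≤ n := by
  induction n generalizing a b with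
  | zero => simp [altProd_zero]
  | succ n ih =>
    rw [altProd_succ]
    have := cs.length_mul_le (cs.simple a) (altProd (cs.simple b) (cs.simple a) n)
    rw [cs.length_simple] at this
    have := ih b a
    omega

/-- Every element factors as an alternating word in `s` and `t` times an element without left
descent in `{s, t}`, and the lengths add up. -/
theorem exists_dihedral_factorization (s t : A) (w : W) :
    ∃ p q n y, ((p = s ∧ q = t) ∨ (p = t ∧ q = s)) ∧
      w = altProd (cs.simple p) (cs.simple q) n * y ∧ cs.length w = n + cs.length y ∧
      ¬ cs.IsLeftDescent y s ∧ ¬ cs.IsLeftDescent y t := by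
  induction hl : cs.length w using Nat.strong_induction_on generalizing w with
  | _ l ih =>
    have key : ∀ p q, ((p = s ∧ q = t) ∨ (p = t ∧ q = s)) → cs.IsLeftDescent w p →
        ∃ p q n y, ((p = s ∧ q = t) ∨ (p = t ∧ q = s)) ∧
        w = altProd (cs.simple p) (cs.simple q) n * y ∧ cs.length w = n + cs.length y ∧
        ¬ cs.IsLeftDescent y s ∧ ¬ cs.IsLeftDescent y t := by
      intro p q hpq hp
      have hlen := cs.isLeftDescent_iff.1 hp
      obtain ⟨p', q', n, y, hpq', hw, hly, hs, ht⟩ :=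
        ih (cs.length (cs.simple p * w)) (by omega) _ rfl
      have hw' : w = cs.simple p * (altProd (cs.simple p') (cs.simple q') n * y) := by
        rw [← hw, cs.simple_mul_simple_cancel_left]
      rcases Nat.eq_zero_or_pos n with rfl | hn
      · refine ⟨p, q, 1, y, hpq, ?_, by omega, hs, ht⟩
        rw [hw']
        simp [altProd_succ, altProd_zero]
      by_cases hpp : p' = p
      · obtain ⟨k, rfl⟩ : ∃ k, n = k + 1 := ⟨n - 1, by omega⟩
        subst hpp
        rw [altProd_succ, mul_assoc, cs.simple_mul_simple_cancel_left] at hw'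
        have h1 := cs.length_mul_le (altProd (cs.simple q') (cs.simple p') k) y
        have h2 := length_altProd_le cs q' p' k
        rw [← hw'] at h1
        omega
      · have h1 : p' = q ∧ q' = p := by
          rcases hpq with ⟨rfl, rfl⟩ | ⟨rfl, rfl⟩ <;> rcases hpq' with ⟨rfl, rfl⟩ | ⟨rfl, rfl⟩ <;>
            simp_all
        obtain ⟨rfl, rfl⟩ := h1
        refine ⟨q', p', n + 1, y, hpq, ?_, by omega, hs, ht⟩
        rw [hw', altProd_succ, mul_assoc]
    rw [← hl]
    by_cases hs : cs.IsLeftDescent w s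
    · exact key s t (Or.inl ⟨rfl, rfl⟩) hs
    by_cases ht : cs.IsLeftDescent w t
    · exact key t s (Or.inr ⟨rfl, rfl⟩) ht
    exact ⟨s, t, 0, w, Or.inl ⟨rfl, rfl⟩, by simp [altProd_zero], by simp, hs, ht⟩

/-- The contragredient geometric representation. -/
noncomputable def geomRep : W →* Function.End (A → ℝ) :=
  cs.lift ⟨geomRefl M, isLiftable_geomRefl M⟩

theorem geomRep_simple (s : A) : geomRep cs (cs.simple s) = geomRefl M s :=
  cs.lift_apply_simple _ s

theorem geomRep_mul_apply (v w : W) (f : A → ℝ) :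
    geomRep cs (v * w) f = geomRep cs v (geomRep cs w f) := by
  rw [map_mul]; rfl

/-- Tits' positivity theorem: a function in the open fundamental chamber is mapped by `w` to a
function that is positive at every `s` that is not a left descent of `w`. -/
theorem geomRep_pos {f : A → ℝ} (hf : ∀ a, 0 < f a) {w : W} {s : A}
    (hs : ¬ cs.IsLeftDescent w s) : 0 < geomRep cs w f s := by
  induction hl : cs.length w using Nat.strong_induction_on generalizing w s with
  | _ l ih =>
    by_cases hw1 : w = 1
    · subst hw1
      rw [map_one]
      exact hf s
    obtain ⟨t, ht⟩ := cs.exists_leftDescent_of_ne_one hw1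
    have hst : s ≠ t := fun h => hs (h ▸ ht)
    obtain ⟨p, q, n, y, hpq, hw, hly, hys, hyt⟩ := exists_dihedral_factorization cs s t w
    have hn : n ≠ 0 := by
      rintro rfl
      rw [altProd_zero, one_mul] at hw
      exact hyt (hw ▸ ht)
    -- `w` has no reduced factorization that starts with `s`.
    have hno : ∀ v : W, w = cs.simple s * v → cs.length w ≤ cs.length v := by
      intro v hv
      have h1 := cs.not_isLeftDescent_iff.1 hs
      rw [hv, cs.simple_mul_simple_cancel_left] at h1
      rw [← hv] at h1
      omega
    have short : ∀ p' q' k, k + 1 = n →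
        cs.length (altProd (cs.simple p') (cs.simple q') k * y) < cs.length w := by
      intro p' q' k hk
      have h1 := cs.length_mul_le (altProd (cs.simple p') (cs.simple q') k) y
      have h2 := length_altProd_le cs p' q' k
      omega
    obtain ⟨k, hk⟩ : ∃ k, k + 1 = n := ⟨n - 1, by omega⟩
    have hpq' : p = t ∧ q = s := by
      rcases hpq with ⟨rfl, rfl⟩ | h
      · exfalso
        have h1 := hno (altProd (cs.simple q) (cs.simple p) k * y) (by
          rw [hw, ← hk, altProd_succ, mul_assoc])
        have h2 := short q p k hk
        omega
      · exact h
    obtain ⟨rfl, rfl⟩ := hpq'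
    have hnm : M q p = 0 ∨ n < M q p := by
      by_contra hcon
      push Not at hcon
      obtain ⟨h0, hge⟩ := hcon
      obtain ⟨j, hj⟩ : ∃ j, n = M q p + j := ⟨n - M q p, by omega⟩
      obtain ⟨i, hi⟩ : ∃ i, M q p = i + 1 := ⟨M q p - 1, by omega⟩
      set r := altProd (if Even (M q p) then cs.simple p else cs.simple q)
        (if Even (M q p) then cs.simple q else cs.simple p) j
      have hr : cs.length r ≤ j := by
        by_cases he : Even (M q p)
        · simpa [r, he] using length_altProd_le cs p q j
        · simpa [r, he] using length_altProd_le cs q p j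
      have h1 := hno (altProd (cs.simple p) (cs.simple q) i * r * y) (by
        rw [hw, hj, altProd_add, ← altProd_simple_comm cs q p]
        conv_lhs => rw [hi]
        rw [altProd_succ]
        simp only [mul_assoc, r, hi])
      have h2 := cs.length_mul_le (altProd (cs.simple p) (cs.simple q) i * r) y
      have h3 := cs.length_mul_le (altProd (cs.simple p) (cs.simple q) i) r
      have h4 := length_altProd_le cs p q i
      omega
    rw [hw, geomRep_mul_apply, map_altProd, geomRep_simple, geomRep_simple]
    exact altProd_geomRefl_pos M hst hnm (ih _ (by omega) hys rfl) (ih _ (by omega) hyt rfl)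

theorem geomRep_neg {f : A → ℝ} (hf : ∀ a, 0 < f a) {w : W} {s : A}
    (hs : cs.IsLeftDescent w s) : geomRep cs w f s < 0 := by
  have h1 := geomRep_pos cs hf (cs.isLeftDescent_iff_not_isLeftDescent_mul.1 hs)
  have h2 : w = cs.simple s * (cs.simple s * w) := by rw [cs.simple_mul_simple_cancel_left]
  rw [h2, geomRep_mul_apply, geomRep_simple, geomRefl_apply_self]
  linarith

/-- An alternating word of length at most `m_{p,q}` is reduced, also in front of an element without
left descent in `{p, q}`. -/
theorem length_altProd_mul {p q : A} (hpq : p ≠ q) {n : ℕ} (hn : M p q = 0 ∨ n ≤ M p q) {y : W}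
    (hp : ¬ cs.IsLeftDescent y p) (hq : ¬ cs.IsLeftDescent y q) :
    cs.length (altProd (cs.simple p) (cs.simple q) n * y) = n + cs.length y := by
  induction n generalizing p q with
  | zero => simp [altProd_zero]
  | succ n ih =>
    have h1 := ih hpq.symm (by rw [M.symmetric q p]; omega) hq hp
    rw [altProd_succ, mul_assoc]
    have hone : ∀ a : A, (0 : ℝ) < (fun _ => 1 : A → ℝ) a := fun _ => one_pos
    have hpos : ¬ cs.IsLeftDescent (altProd (cs.simple q) (cs.simple p) n * y) p := by
      intro h
      have h2 := geomRep_neg cs hone h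
      rw [geomRep_mul_apply, map_altProd, geomRep_simple, geomRep_simple] at h2
      have h3 := altProd_geomRefl_pos M hpq (n := n) (by omega)
        (geomRep_pos cs hone hp) (geomRep_pos cs hone hq)
      linarith
    rw [cs.not_isLeftDescent_iff.1 hpos, h1]
    omega

theorem length_mul_altProd {p q : A} (hpq : p ≠ q) {n : ℕ} (hn : M p q = 0 ∨ n ≤ M p q) {y : W}
    (hp : ¬ cs.IsRightDescent y p) (hq : ¬ cs.IsRightDescent y q) :
    cs.length (y * altProd (cs.simple p) (cs.simple q) n) = cs.length y + n := by
  rw [← cs.isLeftDescent_inv_iff] at hp hq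
  rw [← cs.length_inv, mul_inv_rev, altProd_simple_inv, ← cs.length_inv y, add_comm]
  split_ifs
  · exact length_altProd_mul cs hpq.symm (by rwa [M.symmetric q p]) hq hp
  · exact length_altProd_mul cs hpq hn hp hq

/-- Two left descents `s`, `t` force `m_{s,t} < ∞` and the longest element of the dihedral group of
`s` and `t` as a prefix. -/
theorem exists_eq_altProd_mul_of_isLeftDescent {s t : A} (hst : s ≠ t) {w : W}
    (hs : cs.IsLeftDescent w s) (ht : cs.IsLeftDescent w t) :
    M s t ≠ 0 ∧ ∃ y, w = altProd (cs.simple s) (cs.simple t) (M s t) * y ∧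
      cs.length w = M s t + cs.length y := by
  obtain ⟨p, q, n, y, hpq, hw, hly, hys, hyt⟩ := exists_dihedral_factorization cs s t w
  have hM : M p q = M s t := by
    rcases hpq with ⟨rfl, rfl⟩ | ⟨rfl, rfl⟩
    · rfl
    · exact M.symmetric _ _
  have hne : p ≠ q := by rcases hpq with ⟨rfl, rfl⟩ | ⟨rfl, rfl⟩ <;> [exact hst; exact hst.symm]
  have hq : cs.IsLeftDescent w q := by
    rcases hpq with ⟨rfl, rfl⟩ | ⟨rfl, rfl⟩ <;> assumption
  have hyp : ¬ cs.IsLeftDescent y p := by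
    rcases hpq with ⟨rfl, rfl⟩ | ⟨rfl, rfl⟩ <;> assumption
  have hyq : ¬ cs.IsLeftDescent y q := by
    rcases hpq with ⟨rfl, rfl⟩ | ⟨rfl, rfl⟩ <;> assumption
  have hcon : ¬ (M p q = 0 ∨ n < M p q) := by
    intro h
    have h1 := length_altProd_mul cs hne.symm (n := n + 1) (by rw [M.symmetric q p]; omega) hyq hyp
    rw [altProd_succ, mul_assoc, ← hw] at h1
    have h2 := cs.isLeftDescent_iff.1 hq
    omega
  push Not at hcon
  obtain ⟨h0, hge⟩ := hcon
  have hcomm : altProd (cs.simple p) (cs.simple q) (M s t) =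
      altProd (cs.simple s) (cs.simple t) (M s t) := by
    rcases hpq with ⟨rfl, rfl⟩ | ⟨rfl, rfl⟩
    · rfl
    · exact (altProd_simple_comm cs q p).symm
  obtain ⟨j, hj⟩ : ∃ j, n = M s t + j := ⟨n - M s t, by omega⟩
  set r := altProd (if Even (M s t) then cs.simple p else cs.simple q)
    (if Even (M s t) then cs.simple q else cs.simple p) j with hrdef
  have hr : cs.length r ≤ j := by
    by_cases he : Even (M s t)
    · simpa [r, he] using length_altProd_le cs p q j
    · simpa [r, he] using length_altProd_le cs q p j
  have hw' : w = altProd (cs.simple s) (cs.simple t) (M s t) * (r * y) := by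
    rw [hw, hj, altProd_add, hcomm, mul_assoc]
  refine ⟨by omega, r * y, hw', ?_⟩
  have h1 := cs.length_mul_le r y
  have h2 := cs.length_mul_le (altProd (cs.simple s) (cs.simple t) (M s t)) (r * y)
  have h3 := length_altProd_le cs s t (M s t)
  rw [← hw'] at h2
  omega

/-! ### The weak order -/

/-- The right weak order: `v` is a prefix of a reduced expression of `w`. -/
def IsPrefix (v w : W) : Prop := cs.length v + cs.length (v⁻¹ * w) = cs.length w

theorem isPrefix_mul_iff {v x : W} :
    IsPrefix cs v (v * x) ↔ cs.length (v * x) = cs.length v + cs.length x := by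
  rw [IsPrefix, inv_mul_cancel_left, eq_comm]

theorem IsPrefix.exists_eq {v w : W} (h : IsPrefix cs v w) :
    ∃ x, w = v * x ∧ cs.length w = cs.length v + cs.length x :=
  ⟨v⁻¹ * w, by simp, h.symm⟩

theorem IsPrefix.trans {u v w : W} (h1 : IsPrefix cs u v) (h2 : IsPrefix cs v w) :
    IsPrefix cs u w := by
  obtain ⟨x, rfl, hx⟩ := h1.exists_eq
  obtain ⟨y, rfl, hy⟩ := h2.exists_eq
  have h3 := cs.length_mul_le x y
  have h4 := cs.length_mul_le u (x * y)
  rw [mul_assoc] at hy ⊢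
  rw [isPrefix_mul_iff]
  omega

theorem IsPrefix.antisymm {v w : W} (h1 : IsPrefix cs v w) (h2 : IsPrefix cs w v) : v = w := by
  obtain ⟨x, rfl, hx⟩ := h1.exists_eq
  have h3 : cs.length (v * x) ≤ cs.length v := by rw [IsPrefix] at h2; omega
  have h4 : x = 1 := cs.length_eq_zero_iff.1 (by omega)
  rw [h4, mul_one]

theorem isPrefix_refl (v : W) : IsPrefix cs v v := by simp [IsPrefix]

theorem isPrefix_one (v : W) : IsPrefix cs 1 v := by simp [IsPrefix]

/-- The prefixes `v` of `w` for which the product `u * v` is reduced. -/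
def ReducedPrefix (u w v : W) : Prop :=
  IsPrefix cs v w ∧ cs.length (u * v) = cs.length u + cs.length v

theorem ReducedPrefix.of_isPrefix {u w v v' : W} (h : ReducedPrefix cs u w v)
    (hv : IsPrefix cs v' v) : ReducedPrefix cs u w v' := by
  refine ⟨hv.trans cs h.1, ?_⟩
  obtain ⟨x, rfl, hx⟩ := hv.exists_eq
  have h1 := h.2
  have h2 := cs.length_mul_le (u * v') x
  have h3 := cs.length_mul_le u v'
  rw [mul_assoc] at h2
  omega

/-- Local confluence: two ways to prolong a reduced prefix by one letter have a common
prolongation. -/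
theorem ReducedPrefix.mul_altProd {u w v : W} {a b : A} (hab : a ≠ b)
    (hva : IsPrefix cs v (v * cs.simple a)) (hvb : IsPrefix cs v (v * cs.simple b))
    (ha : ReducedPrefix cs u w (v * cs.simple a)) (hb : ReducedPrefix cs u w (v * cs.simple b)) :
    ∃ z, ReducedPrefix cs u w z ∧ IsPrefix cs (v * cs.simple a) z ∧
      IsPrefix cs (v * cs.simple b) z := by
  have hv := ha.of_isPrefix cs hva
  obtain ⟨x, rfl, hx⟩ := hv.1.exists_eq
  have desc : ∀ c, IsPrefix cs v (v * cs.simple c) → ReducedPrefix cs u (v * x) (v * cs.simple c) →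
      cs.IsLeftDescent x c := by
    intro c hc h
    have h1 := h.1
    rw [isPrefix_mul_iff, cs.length_simple] at hc
    rw [IsPrefix, mul_inv_rev, mul_assoc, inv_mul_cancel_left, cs.inv_simple] at h1
    rw [cs.isLeftDescent_iff]
    omega
  have ndesc : ∀ c, IsPrefix cs v (v * cs.simple c) → ReducedPrefix cs u (v * x) (v * cs.simple c) →
      ¬ cs.IsRightDescent (u * v) c := by
    intro c hc h
    have h1 := h.2
    rw [isPrefix_mul_iff, cs.length_simple] at hc
    rw [cs.not_isRightDescent_iff, mul_assoc, h1, hc, hv.2]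
    omega
  obtain ⟨h0, y, rfl, hy⟩ :=
    exists_eq_altProd_mul_of_isLeftDescent cs hab (desc a hva ha) (desc b hvb hb)
  set D := altProd (cs.simple a) (cs.simple b) (M a b) with hD
  have hlD := length_altProd_le cs a b (M a b)
  have h1 := length_mul_altProd cs hab (Or.inr le_rfl) (ndesc a hva ha) (ndesc b hvb hb)
  rw [← hD] at h1 hlD
  have h2 := cs.length_mul_le (v * D) y
  have h3 := cs.length_mul_le v D
  have h4 := cs.length_mul_le u (v * D)
  have h5 := hv.2
  rw [mul_assoc] at h1 h2
  have hpre : ∀ c c', D = altProd (cs.simple c) (cs.simple c') (M a b) →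
      IsPrefix cs v (v * cs.simple c) → IsPrefix cs (v * cs.simple c) (v * D) := by
    intro c c' hc hp
    obtain ⟨k, hk⟩ : ∃ k, M a b = k + 1 := ⟨M a b - 1, by omega⟩
    rw [isPrefix_mul_iff, cs.length_simple] at hp
    have h6 : v * D = v * cs.simple c * altProd (cs.simple c') (cs.simple c) k := by
      rw [hc, hk, altProd_succ, mul_assoc]
    have h7 := length_altProd_le cs c' c k
    have h8 := cs.length_mul_le (v * cs.simple c) (altProd (cs.simple c') (cs.simple c) k)
    rw [h6, isPrefix_mul_iff]
    rw [h6] at h3 h4 h2 h1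
    omega
  refine ⟨v * D, ⟨?_, ?_⟩, hpre a b hD hva, hpre b a (hD.trans (altProd_simple_comm cs a b)) hvb⟩
  · rw [← mul_assoc, isPrefix_mul_iff, mul_assoc]
    omega
  · omega

theorem IsPrefix.exists_simple {v w : W} (h : IsPrefix cs v w) (hne : v ≠ w) :
    ∃ a, IsPrefix cs v (v * cs.simple a) ∧ IsPrefix cs (v * cs.simple a) w := by
  obtain ⟨x, rfl, hx⟩ := h.exists_eq
  have hx1 : x ≠ 1 := by rintro rfl; simp at hne
  obtain ⟨a, ha⟩ := cs.exists_leftDescent_of_ne_one hx1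
  rw [cs.isLeftDescent_iff] at ha
  have e : v * x = v * cs.simple a * (cs.simple a * x) := by
    rw [mul_assoc, cs.simple_mul_simple_cancel_left]
  have h1 := cs.length_mul_le (v * cs.simple a) (cs.simple a * x)
  have h2 := cs.length_mul_le v (cs.simple a)
  rw [← e] at h1
  rw [cs.length_simple] at h2
  refine ⟨a, ?_, ?_⟩
  · rw [isPrefix_mul_iff, cs.length_simple]; omega
  · rw [e, isPrefix_mul_iff, ← e]; omega

/-- Newman's argument: local confluence gives a largest reduced prefix. -/
theorem exists_greatest_reducedPrefix (u w : W) :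
    ∃ m, ReducedPrefix cs u w m ∧ ∀ v, ReducedPrefix cs u w v → IsPrefix cs v m := by
  have key : ∀ k v, ReducedPrefix cs u w v → cs.length w - cs.length v = k →
      ∃ m, ReducedPrefix cs u w m ∧
        ∀ v', ReducedPrefix cs u w v' → IsPrefix cs v v' → IsPrefix cs v' m := by
    intro k
    induction k using Nat.strong_induction_on with
    | _ k ih =>
      intro v hv hk
      by_cases hmax : ∃ a, IsPrefix cs v (v * cs.simple a) ∧ ReducedPrefix cs u w (v * cs.simple a)
      · have step : ∀ c, IsPrefix cs v (v * cs.simple c) → ReducedPrefix cs u w (v * cs.simple c) →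
            ∃ m, ReducedPrefix cs u w m ∧ ∀ v', ReducedPrefix cs u w v' →
              IsPrefix cs (v * cs.simple c) v' → IsPrefix cs v' m := by
          intro c hc h
          refine ih _ ?_ _ h rfl
          have h1 := h.1
          rw [isPrefix_mul_iff, cs.length_simple] at hc
          rw [IsPrefix] at h1
          omega
        obtain ⟨a, hva, ha⟩ := hmax
        obtain ⟨m, hm, hmmax⟩ := step a hva ha
        refine ⟨m, hm, fun v' hv' hvv' => ?_⟩
        by_cases hne : v = v'
        · subst hne
          exact hva.trans cs (hmmax _ ha (isPrefix_refl cs _))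
        obtain ⟨b, hvb, hbv'⟩ := hvv'.exists_simple cs hne
        have hb := hv'.of_isPrefix cs hbv'
        by_cases hab : a = b
        · subst hab
          exact hmmax _ hv' hbv'
        obtain ⟨m', hm', hmmax'⟩ := step b hvb hb
        obtain ⟨z, hz, haz, hbz⟩ := ReducedPrefix.mul_altProd cs hab hva hvb ha hb
        exact (hmmax' _ hv' hbv').trans cs (hmmax _ hm' (haz.trans cs (hmmax' _ hz hbz)))
      · refine ⟨v, hv, fun v' hv' hvv' => ?_⟩
        by_cases hne : v = v'
        · rw [← hne]; exact isPrefix_refl cs v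
        · obtain ⟨b, hvb, hbv'⟩ := hvv'.exists_simple cs hne
          exact (hmax ⟨b, hvb, hv'.of_isPrefix cs hbv'⟩).elim
  obtain ⟨m, hm, hmax⟩ := key _ 1 ⟨isPrefix_one cs w, by simp⟩ rfl
  exact ⟨m, hm, fun v hv => hmax v hv (isPrefix_one cs v)⟩

/-- The largest prefix `v` of `w` for which `u * v` is reduced. -/
noncomputable def maxPrefix (u w : W) : W := (exists_greatest_reducedPrefix cs u w).choose

theorem maxPrefix_spec (u w : W) : ReducedPrefix cs u w (maxPrefix cs u w) :=
  (exists_greatest_reducedPrefix cs u w).choose_spec.1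

theorem isPrefix_maxPrefix {u w v : W} (h : ReducedPrefix cs u w v) :
    IsPrefix cs v (maxPrefix cs u w) :=
  (exists_greatest_reducedPrefix cs u w).choose_spec.2 v h

theorem maxPrefix_one (w : W) : maxPrefix cs 1 w = w :=
  (maxPrefix_spec cs 1 w).1.antisymm cs
    (isPrefix_maxPrefix cs ⟨isPrefix_refl cs w, by simp⟩)

/-- Cocycle rule for the largest reduced prefix. -/
theorem maxPrefix_mul {x u : W} (hxu : cs.length (x * u) = cs.length x + cs.length u) (w : W) :
    maxPrefix cs x (u * maxPrefix cs u w) = u * maxPrefix cs (x * u) w := by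
  have h0 := maxPrefix_spec cs u w
  have h1 := maxPrefix_spec cs (x * u) w
  have h2 := maxPrefix_spec cs x (u * maxPrefix cs u w)
  set v0 := maxPrefix cs u w
  set v1 := maxPrefix cs (x * u) w
  set y := maxPrefix cs x (u * v0)
  -- `u` itself is an admissible prefix, so `y = u * z`.
  have hu : IsPrefix cs u y := isPrefix_maxPrefix cs ⟨(isPrefix_mul_iff cs).2 h0.2, hxu⟩
  obtain ⟨z, hz, hlz⟩ := hu.exists_eq
  have a1 : cs.length (u * v1) = cs.length u + cs.length v1 := by
    have e1 := cs.length_mul_le x (u * v1)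
    have e2 := cs.length_mul_le u v1
    have e3 := h1.2
    rw [mul_assoc] at e3
    omega
  have hv10 : IsPrefix cs v1 v0 := isPrefix_maxPrefix cs ⟨h1.1, a1⟩
  apply (IsPrefix.antisymm cs)
  · have hz0 : IsPrefix cs z v0 := by
      have := h2.1
      rw [IsPrefix, hz, mul_inv_rev, mul_assoc, inv_mul_cancel_left, h0.2, ← hz, hlz] at this
      rw [IsPrefix]; omega
    have hz1 : IsPrefix cs z v1 := by
      refine isPrefix_maxPrefix cs ⟨hz0.trans cs h0.1, ?_⟩
      have := h2.2
      rw [hz, ← mul_assoc] at this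
      rw [← hz, hlz] at this
      omega
    obtain ⟨r, hr, hlr⟩ := hz1.exists_eq
    rw [hr, ← mul_assoc, ← hz, isPrefix_mul_iff]
    rw [hr, ← mul_assoc, ← hz] at a1
    rw [hr] at hlr
    omega
  · refine isPrefix_maxPrefix cs ⟨?_, ?_⟩
    · obtain ⟨r, hr, hlr⟩ := hv10.exists_eq
      have h3 := h0.2
      rw [hr, ← mul_assoc, isPrefix_mul_iff]
      rw [hr, ← mul_assoc] at h3
      rw [hr] at hlr
      omega
    · have := h1.2
      rw [mul_assoc] at this
      omega

end

/-! ### Reduced lifts from the Coxeter group to the Artin--Tits monoid -/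

/-- The atom of the Artin--Tits monoid attached to a letter. -/
def atom (M : CoxeterMatrix A) (a : A) : ArtinTitsMonoid M := PresentedMonoid.of (BraidRel M) a

theorem atom_induction {M : CoxeterMatrix A} {C : ArtinTitsMonoid M → Prop} (one : C 1)
    (mul : ∀ a p, C p → C (atom M a * p)) (p : ArtinTitsMonoid M) : C p := by
  obtain ⟨w, rfl⟩ := PresentedMonoid.surjective_mk p
  induction w using FreeMonoid.recOn with
  | one => rw [map_one]; exact one
  | of_mul a w h => rw [map_mul]; exact mul a _ h

theorem mk_ofList (M : CoxeterMatrix A) (l : List A) :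
    PresentedMonoid.mk (BraidRel M) (FreeMonoid.ofList l) = (l.map (atom M)).prod := by
  induction l with
  | nil => simp
  | cons a l ih =>
    rw [FreeMonoid.ofList_cons, map_mul, ih, List.map_cons, List.prod_cons]
    rfl

theorem altProd_atom_comm (M : CoxeterMatrix A) {a b : A} (h : M a b ≠ 0) :
    altProd (atom M a) (atom M b) (M a b) = altProd (atom M b) (atom M a) (M a b) := by
  have h1 := PresentedMonoid.mk_eq_mk_of_rel (BraidRel.braid a b h)
  rw [mk_ofList, mk_ofList, CoxeterSystem.braidWord, CoxeterSystem.braidWord,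
    prod_map_alternatingWord, prod_map_alternatingWord, M.symmetric b a] at h1
  split_ifs at h1
  · exact h1
  · exact h1.symm

/-- The homomorphism from the Artin--Tits monoid that is given on the atoms by `f`. -/
def liftAtoms {M : CoxeterMatrix A} {G : Type*} [Monoid G] (f : A → G)
    (h : ∀ a b, M a b ≠ 0 → altProd (f a) (f b) (M a b) = altProd (f b) (f a) (M a b)) :
    ArtinTitsMonoid M →* G :=
  PresentedMonoid.lift f (by
    rintro _ _ ⟨a, b, h0⟩
    rw [FreeMonoid.lift_apply, FreeMonoid.lift_apply, FreeMonoid.toList_ofList,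
      FreeMonoid.toList_ofList, CoxeterSystem.braidWord, CoxeterSystem.braidWord,
      prod_map_alternatingWord, prod_map_alternatingWord, M.symmetric b a, h a b h0])

theorem liftAtoms_atom {M : CoxeterMatrix A} {G : Type*} [Monoid G] (f : A → G)
    (h : ∀ a b, M a b ≠ 0 → altProd (f a) (f b) (M a b) = altProd (f b) (f a) (M a b)) (a : A) :
    liftAtoms f h (atom M a) = f a :=
  PresentedMonoid.lift_of f _

theorem exists_altList {M : CoxeterMatrix A} {W : Type*} [Group W] (cs : CoxeterSystem M W)
    (a b : A) (n : ℕ) : ∃ l : List A, l.length = n ∧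
      cs.wordProd l = altProd (cs.simple a) (cs.simple b) n ∧
      (l.map (atom M)).prod = altProd (atom M a) (atom M b) n := by
  induction n generalizing a b with
  | zero => exact ⟨[], rfl, by simp [altProd_zero], by simp [altProd_zero]⟩
  | succ n ih =>
    obtain ⟨l, h1, h2, h3⟩ := ih b a
    exact ⟨a :: l, by simp [h1], by rw [cs.wordProd_cons, h2, altProd_succ],
      by rw [List.map_cons, List.prod_cons, h3, altProd_succ]⟩

section

variable {M : CoxeterMatrix A} {W : Type*} [Group W] (cs : CoxeterSystem M W)

theorem isLeftDescent_of_isReduced_cons {a : A} {l : List A} (h : cs.IsReduced (a :: l)) :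
    cs.IsLeftDescent (cs.wordProd (a :: l)) a := by
  rw [CoxeterSystem.IsLeftDescent, h.eq, cs.wordProd_cons, cs.simple_mul_simple_cancel_left]
  have := cs.length_wordProd_le l
  simp only [List.length_cons]
  omega

theorem isReduced_of_wordProd_eq {l : List A} {w : W} (h : cs.wordProd l = w)
    (hl : l.length ≤ cs.length w) : cs.IsReduced l := by
  have := cs.length_wordProd_le l
  rw [CoxeterSystem.IsReduced]
  rw [h] at this ⊢
  omega

/-- Matsumoto's theorem: two reduced words for the same element of the Coxeter group represent the
same element of the Artin--Tits monoid. -/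
theorem prod_map_atom_eq_of_isReduced {l l' : List A} (hl : cs.IsReduced l)
    (hl' : cs.IsReduced l') (h : cs.wordProd l = cs.wordProd l') :
    (l.map (atom M)).prod = (l'.map (atom M)).prod := by
  induction hn : l.length generalizing l l' with
  | zero =>
    have h1 := hl.eq
    rw [h, hl'.eq, hn] at h1
    rw [List.length_eq_zero_iff.1 hn, List.length_eq_zero_iff.1 h1]
  | succ n ih =>
    have hn' : l'.length = n + 1 := by rw [← hl'.eq, ← h, hl.eq, hn]
    obtain ⟨a, l, rfl⟩ := List.exists_cons_of_length_eq_add_one hn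
    obtain ⟨b, l', rfl⟩ := List.exists_cons_of_length_eq_add_one hn'
    have hla : cs.IsReduced l := hl.drop 1
    have hla' : cs.IsReduced l' := hl'.drop 1
    simp only [List.length_cons, Nat.add_right_cancel_iff] at hn hn'
    by_cases hab : a = b
    · subst hab
      rw [cs.wordProd_cons, cs.wordProd_cons, mul_right_inj] at h
      rw [List.map_cons, List.map_cons, List.prod_cons, List.prod_cons, ih hla hla' h hn]
    -- Both words are compared with a word that starts with the longest element of the dihedral
    -- group of `a` and `b`.
    have hda := isLeftDescent_of_isReduced_cons cs hl
    have hdb := isLeftDescent_of_isReduced_cons cs hl'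
    rw [← h] at hdb
    obtain ⟨h0, y, hy, hly⟩ := exists_eq_altProd_mul_of_isLeftDescent cs hab hda hdb
    obtain ⟨ly, hyr, rfl⟩ := cs.exists_isReduced y
    rw [hl.eq, hyr.eq, List.length_cons, hn] at hly
    obtain ⟨k, hk⟩ : ∃ k, M a b = k + 1 := ⟨M a b - 1, by omega⟩
    have tail : ∀ (c d : A) (r : List A), cs.IsReduced r → r.length = n →
        cs.simple c * cs.wordProd r =
          altProd (cs.simple c) (cs.simple d) (M a b) * cs.wordProd ly →
        (r.map (atom M)).prod = altProd (atom M d) (atom M c) k * (ly.map (atom M)).prod := by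
      intro c d r hr hrn hrc
      obtain ⟨m, h1, h2, h3⟩ := exists_altList cs d c k
      rw [hk, altProd_succ, mul_assoc, mul_right_inj, ← h2, ← cs.wordProd_append] at hrc
      rw [ih hr (isReduced_of_wordProd_eq cs hrc.symm ?_) hrc hrn, List.map_append,
        List.prod_append, h3]
      rw [hr.eq, List.length_append, h1]
      omega
    rw [List.map_cons, List.map_cons, List.prod_cons, List.prod_cons,
      tail a b l hla hn (by rw [← hy, cs.wordProd_cons]),
      tail b a l' hla' hn' (by
        rw [← cs.wordProd_cons, ← h, hy, altProd_simple_comm cs a b]),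
      ← mul_assoc, ← mul_assoc, ← altProd_succ, ← altProd_succ, ← hk, altProd_atom_comm M h0]

/-- The lift of an element of the Coxeter group along any of its reduced words. -/
noncomputable def reducedLift (w : W) : ArtinTitsMonoid M :=
  ((cs.exists_isReduced w).choose.map (atom M)).prod

theorem reducedLift_wordProd {l : List A} (hl : cs.IsReduced l) :
    reducedLift cs (cs.wordProd l) = (l.map (atom M)).prod :=
  prod_map_atom_eq_of_isReduced cs (cs.exists_isReduced (cs.wordProd l)).choose_spec.1 hl
    (cs.exists_isReduced (cs.wordProd l)).choose_spec.2.symm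

theorem reducedLift_one : reducedLift cs 1 = 1 := by
  have := reducedLift_wordProd cs (l := []) (by simp [CoxeterSystem.IsReduced])
  simpa using this

theorem reducedLift_simple (a : A) : reducedLift cs (cs.simple a) = atom M a := by
  have := reducedLift_wordProd cs (l := [a]) (by simp [CoxeterSystem.IsReduced])
  simpa using this

theorem reducedLift_mul {u v : W} (h : cs.length (u * v) = cs.length u + cs.length v) :
    reducedLift cs (u * v) = reducedLift cs u * reducedLift cs v := by
  obtain ⟨l, hl, rfl⟩ := cs.exists_isReduced u
  obtain ⟨l', hl', rfl⟩ := cs.exists_isReduced v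
  rw [← cs.wordProd_append, reducedLift_wordProd cs hl, reducedLift_wordProd cs hl',
    reducedLift_wordProd cs (isReduced_of_wordProd_eq cs rfl ?_), List.map_append, List.prod_append]
  rw [cs.wordProd_append, h, hl.eq, hl'.eq, List.length_append]

theorem reducedLift_altProd {a b : A} (hab : a ≠ b) {n : ℕ} (hn : M a b = 0 ∨ n ≤ M a b) :
    reducedLift cs (altProd (cs.simple a) (cs.simple b) n) = altProd (atom M a) (atom M b) n := by
  obtain ⟨l, h1, h2, h3⟩ := exists_altList cs a b n
  have h4 := length_altProd_mul cs hab hn (cs.not_isLeftDescent_one a) (cs.not_isLeftDescent_one b)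
  rw [mul_one, cs.length_one] at h4
  rw [← h2, reducedLift_wordProd cs (isReduced_of_wordProd_eq cs h2 (by omega)), h3]

/-! ### The greedy action -/

/-- Left multiplication by `u` on pairs `(w, q)`, which represent `w * q` with `w` reduced: `u` takes
as much from `w` as the length allows, and the rest of `w` moves to `q`. -/
noncomputable def greedyAct (u : W) : Function.End (W × ArtinTitsMonoid M) := fun x =>
  (u * maxPrefix cs u x.1, reducedLift cs ((maxPrefix cs u x.1)⁻¹ * x.1) * x.2)

theorem greedyAct_apply (u w : W) (q : ArtinTitsMonoid M) : greedyAct cs u (w, q) =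
    (u * maxPrefix cs u w, reducedLift cs ((maxPrefix cs u w)⁻¹ * w) * q) := rfl

theorem greedyAct_one : greedyAct cs (1 : W) = 1 := by
  funext ⟨w, q⟩
  rw [greedyAct_apply, maxPrefix_one, inv_mul_cancel, reducedLift_one, one_mul, one_mul]
  rfl

theorem greedyAct_mul {x u : W} (hxu : cs.length (x * u) = cs.length x + cs.length u) :
    greedyAct cs (x * u) = greedyAct cs x * greedyAct cs u := by
  funext ⟨w, q⟩
  change _ = greedyAct cs x (greedyAct cs u (w, q))
  rw [greedyAct_apply, greedyAct_apply, greedyAct_apply, maxPrefix_mul cs hxu]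
  have h0 := maxPrefix_spec cs u w
  have h1 := maxPrefix_spec cs (x * u) w
  have h2 : IsPrefix cs (maxPrefix cs (x * u) w) (maxPrefix cs u w) := by
    refine isPrefix_maxPrefix cs ⟨h1.1, ?_⟩
    have e1 := cs.length_mul_le x (u * maxPrefix cs (x * u) w)
    have e2 := cs.length_mul_le u (maxPrefix cs (x * u) w)
    have e3 := h1.2
    rw [mul_assoc] at e3
    omega
  have e : (maxPrefix cs (x * u) w)⁻¹ * w = ((maxPrefix cs (x * u) w)⁻¹ * maxPrefix cs u w) *
      ((maxPrefix cs u w)⁻¹ * w) := by group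
  rw [mul_inv_rev, mul_assoc _ u⁻¹, inv_mul_cancel_left, mul_assoc x, ← mul_assoc _ _ q,
    ← reducedLift_mul, ← e]
  rw [← e]
  have e1 := h1.1
  have e2 := h0.1
  rw [IsPrefix] at e1 e2 h2
  omega

theorem altProd_greedyAct {a b : A} (hab : a ≠ b) {n : ℕ} (hn : M a b = 0 ∨ n ≤ M a b) :
    altProd (greedyAct cs (cs.simple a)) (greedyAct cs (cs.simple b)) n =
      greedyAct cs (altProd (cs.simple a) (cs.simple b) n) := by
  have len : ∀ {a b : A}, a ≠ b → ∀ {n : ℕ}, M a b = 0 ∨ n ≤ M a b →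
      cs.length (altProd (cs.simple a) (cs.simple b) n) = n := by
    intro a b hab n hn
    have := length_altProd_mul cs hab hn (cs.not_isLeftDescent_one a) (cs.not_isLeftDescent_one b)
    simpa using this
  induction n generalizing a b with
  | zero => rw [altProd_zero, altProd_zero, greedyAct_one]
  | succ n ih =>
    have hn' : M b a = 0 ∨ n ≤ M b a := by rw [M.symmetric b a]; omega
    rw [altProd_succ, ih hab.symm hn', altProd_succ, greedyAct_mul]
    rw [← altProd_succ, len hab hn, len hab.symm hn', cs.length_simple, add_comm]

/-- The greedy action of the Artin--Tits monoid. -/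
noncomputable def greedyHom : ArtinTitsMonoid M →* Function.End (W × ArtinTitsMonoid M) :=
  liftAtoms (fun a => greedyAct cs (cs.simple a)) fun a b h0 => by
    by_cases hab : a = b
    · rw [hab]
    · rw [altProd_greedyAct cs hab (Or.inr le_rfl),
        altProd_greedyAct cs (Ne.symm hab) (Or.inr (M.symmetric a b).le), altProd_simple_comm]

theorem greedyHom_atom_mul (a : A) (p : ArtinTitsMonoid M) (x : W × ArtinTitsMonoid M) :
    greedyHom cs (atom M a * p) x = greedyAct cs (cs.simple a) (greedyHom cs p x) := by
  rw [map_mul, greedyHom, liftAtoms_atom]; rfl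

theorem length_simple_mul_maxPrefix (a : A) (w : W) :
    cs.length (cs.simple a * maxPrefix cs (cs.simple a) w) =
      cs.length (maxPrefix cs (cs.simple a) w) + 1 := by
  rw [(maxPrefix_spec cs (cs.simple a) w).2, cs.length_simple, add_comm]

theorem reducedLift_maxPrefix_mul (u w : W) :
    reducedLift cs (maxPrefix cs u w) * reducedLift cs ((maxPrefix cs u w)⁻¹ * w) =
      reducedLift cs w := by
  have h := (maxPrefix_spec cs u w).1
  rw [IsPrefix] at h
  rw [← reducedLift_mul, mul_inv_cancel_left]
  rw [mul_inv_cancel_left, h]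

/-- The greedy action moves `(1, 1)`, which represents `1`, to a pair that represents `p`. -/
theorem reducedLift_greedyHom_mul (p : ArtinTitsMonoid M) :
    reducedLift cs (greedyHom cs p (1, 1)).1 * (greedyHom cs p (1, 1)).2 = p := by
  induction p using atom_induction with
  | one =>
    rw [map_one]
    change reducedLift cs 1 * 1 = 1
    rw [reducedLift_one, one_mul]
  | mul a p ih =>
    rw [greedyHom_atom_mul]
    generalize greedyHom cs p (1, 1) = x at *
    obtain ⟨w, q⟩ := x
    rw [greedyAct_apply]
    dsimp only at ih ⊢
    rw [reducedLift_mul, reducedLift_simple, mul_assoc, ← mul_assoc _ _ q,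
      reducedLift_maxPrefix_mul, ih]
    rw [cs.length_simple, length_simple_mul_maxPrefix, add_comm]

/-- The reduced part of the greedy factorization detects the atoms that divide an element. -/
theorem isLeftDescent_greedyHom (a : A) (p : ArtinTitsMonoid M) :
    cs.IsLeftDescent (greedyHom cs (atom M a * p) (1, 1)).1 a := by
  rw [greedyHom_atom_mul]
  change cs.IsLeftDescent (cs.simple a * maxPrefix cs (cs.simple a) _) a
  rw [CoxeterSystem.IsLeftDescent, length_simple_mul_maxPrefix, cs.simple_mul_simple_cancel_left]
  omega

/-- The greedy action of an atom can be undone, which is left cancellation. -/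
theorem reducedLift_simple_mul_greedyHom (a : A) (p : ArtinTitsMonoid M) :
    reducedLift cs (cs.simple a * (greedyHom cs (atom M a * p) (1, 1)).1) *
      (greedyHom cs (atom M a * p) (1, 1)).2 = p := by
  conv_rhs => rw [← reducedLift_greedyHom_mul cs p]
  rw [greedyHom_atom_mul]
  generalize greedyHom cs p (1, 1) = x
  obtain ⟨w, q⟩ := x
  rw [greedyAct_apply]
  dsimp only
  rw [cs.simple_mul_simple_cancel_left, ← mul_assoc, reducedLift_maxPrefix_mul]

end

/-! ### Cancellation and least common multiples -/

variable {M : CoxeterMatrix A}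

instance : IsLeftCancelMul (ArtinTitsMonoid M) where
  mul_left_cancel p := by
    induction p using atom_induction with
    | one => intro x y h; simpa using h
    | mul a p ih =>
      intro x y h
      refine ih ?_
      dsimp only at h ⊢
      rw [mul_assoc, mul_assoc] at h
      rw [← reducedLift_simple_mul_greedyHom M.toCoxeterSystem a (p * x), h,
        reducedLift_simple_mul_greedyHom]

/-- The complement `b⁻¹ lcm(b, t)` of the atoms `b` and `t` if `m_{b,t} < ∞`. -/
def compl (M : CoxeterMatrix A) (b t : A) : ArtinTitsMonoid M :=
  altProd (atom M t) (atom M b) (M b t - 1)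

theorem atom_mul_compl {b t : A} (h : M b t ≠ 0) :
    atom M b * compl M b t = altProd (atom M b) (atom M t) (M b t) := by
  obtain ⟨k, hk⟩ : ∃ k, M b t = k + 1 := ⟨M b t - 1, by omega⟩
  rw [compl, hk, Nat.add_sub_cancel, altProd_succ]

theorem atom_mul_compl_comm {b t : A} (h : M b t ≠ 0) :
    atom M b * compl M b t = atom M t * compl M t b := by
  rw [atom_mul_compl h, atom_mul_compl (by rwa [M.symmetric t b]), altProd_atom_comm M h,
    M.symmetric b t]

/-- The lcm property of two atoms: if `b * x` is a multiple of `t ≠ b`, then it is a multiple of the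
lcm of `b` and `t`. -/
theorem compl_dvd {b t : A} (hbt : b ≠ t) {x : ArtinTitsMonoid M} (h : atom M t ∣ atom M b * x) :
    M b t ≠ 0 ∧ compl M b t ∣ x := by
  obtain ⟨y, hy⟩ := h
  set cs := M.toCoxeterSystem
  have hb := isLeftDescent_greedyHom cs b x
  have ht := isLeftDescent_greedyHom cs t y
  rw [← hy] at ht
  obtain ⟨h0, z, hz, hlz⟩ := exists_eq_altProd_mul_of_isLeftDescent cs hbt hb ht
  refine ⟨h0, ?_⟩
  have h1 := reducedLift_greedyHom_mul cs (atom M b * x)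
  have hlen := length_altProd_mul cs hbt (n := M b t) (Or.inr le_rfl)
    (cs.not_isLeftDescent_one b) (cs.not_isLeftDescent_one t)
  rw [mul_one, cs.length_one, add_zero] at hlen
  rw [hz] at hlz h1
  rw [reducedLift_mul cs (by rw [hlz, hlen]), reducedLift_altProd cs hbt (Or.inr le_rfl),
    ← atom_mul_compl h0, mul_assoc, mul_assoc] at h1
  exact ⟨_, (mul_left_cancel h1).symm⟩

/-- The word length. -/
def wordLength (M : CoxeterMatrix A) : ArtinTitsMonoid M →* Multiplicative ℕ :=
  liftAtoms (fun _ => Multiplicative.ofAdd 1) fun _ _ _ => rfl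

theorem wordLength_atom (a : A) : wordLength M (atom M a) = Multiplicative.ofAdd 1 :=
  liftAtoms_atom _ _ a

/-- The word length as a natural number. -/
def len (p : ArtinTitsMonoid M) : ℕ := Multiplicative.toAdd (wordLength M p)

theorem len_mul (p q : ArtinTitsMonoid M) : len (p * q) = len p + len q := by
  rw [len, map_mul, toAdd_mul]; rfl

theorem len_atom (a : A) : len (atom M a) = 1 := by rw [len, wordLength_atom]; rfl

theorem len_one : len (1 : ArtinTitsMonoid M) = 0 := by rw [len, map_one]; rfl

theorem eq_one_or_exists_atom_mul (p : ArtinTitsMonoid M) :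
    p = 1 ∨ ∃ a q, p = atom M a * q := by
  induction p using atom_induction with
  | one => exact Or.inl rfl
  | mul a p _ => exact Or.inr ⟨a, p, rfl⟩

theorem not_atom_dvd_one (a : A) : ¬ atom M a ∣ 1 := by
  rintro ⟨x, hx⟩
  have := len_mul (atom M a) x
  rw [← hx, len_one, len_atom] at this
  omega

/-- `z` is a least common right multiple of `x` and `y`. -/
def IsLcm {P : Type*} [Monoid P] (x y z : P) : Prop :=
  x ∣ z ∧ y ∣ z ∧ ∀ w, x ∣ w → y ∣ w → z ∣ w

theorem mul_dvd_mul_left_iff' (c : ArtinTitsMonoid M) {x y : ArtinTitsMonoid M} :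
    c * x ∣ c * y ↔ x ∣ y := by
  refine ⟨?_, mul_dvd_mul_left c⟩
  rintro ⟨z, hz⟩
  rw [mul_assoc] at hz
  exact ⟨z, mul_left_cancel hz⟩

/-- Artin--Tits monoids are right LCM monoids. -/
theorem exists_isLcm {x y m : ArtinTitsMonoid M} (hx : x ∣ m) (hy : y ∣ m) :
    ∃ z, IsLcm x y z := by
  induction hn : len m using Nat.strong_induction_on generalizing x y m with
  | _ n ih =>
    rcases eq_one_or_exists_atom_mul x with rfl | ⟨a, x, rfl⟩
    · exact ⟨y, one_dvd y, dvd_rfl, fun w _ h => h⟩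
    rcases eq_one_or_exists_atom_mul y with rfl | ⟨b, y, rfl⟩
    · exact ⟨atom M a * x, dvd_rfl, one_dvd _, fun w h _ => h⟩
    have short : ∀ {c : A} {k : ArtinTitsMonoid M}, m = atom M c * k → len k < n := by
      intro c k hk
      rw [← hn, hk, len_mul, len_atom]
      omega
    obtain ⟨m1, hm1⟩ := (dvd_mul_right (atom M a) x).trans hx
    obtain ⟨m2, hm2⟩ := (dvd_mul_right (atom M b) y).trans hy
    rw [hm1, mul_dvd_mul_left_iff'] at hx
    rw [hm2, mul_dvd_mul_left_iff'] at hy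
    by_cases hab : a = b
    · subst hab
      have h12 : m1 = m2 := mul_left_cancel (hm1.symm.trans hm2)
      subst h12
      obtain ⟨z, hxz, hyz, hz⟩ := ih _ (short hm1) hx hy rfl
      refine ⟨atom M a * z, mul_dvd_mul_left _ hxz, mul_dvd_mul_left _ hyz, fun w hxw hyw => ?_⟩
      obtain ⟨w, rfl⟩ := (dvd_mul_right (atom M a) x).trans hxw
      rw [mul_dvd_mul_left_iff'] at *
      exact hz w hxw hyw
    -- Compare both elements with the lcm of their first letters.
    obtain ⟨h0, hc1⟩ := compl_dvd hab (x := m1) ⟨m2, hm1.symm.trans hm2⟩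
    obtain ⟨-, hc2⟩ := compl_dvd (Ne.symm hab) (x := m2) ⟨m1, hm2.symm.trans hm1⟩
    obtain ⟨z1, hxz1, ⟨s, rfl⟩, hz1⟩ := ih _ (short hm1) hx hc1 rfl
    obtain ⟨z2, hyz2, ⟨t, rfl⟩, hz2⟩ := ih _ (short hm2) hy hc2 rfl
    obtain ⟨e1, rfl⟩ := hz1 _ hx hc1
    obtain ⟨e2, rfl⟩ := hz2 _ hy hc2
    have heq : s * e1 = t * e2 := by
      have := hm1.symm.trans hm2
      rw [mul_assoc, mul_assoc, ← mul_assoc (atom M a), ← mul_assoc (atom M b),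
        ← atom_mul_compl_comm h0] at this
      exact mul_left_cancel this
    have hlt : len (s * e1) < n := by
      rw [← hn, hm1, mul_assoc (compl M a b), len_mul (atom M a), len_mul (compl M a b), len_atom]
      omega
    obtain ⟨z3, hs, ht, hz3⟩ := ih _ hlt (dvd_mul_right s e1) (heq ▸ dvd_mul_right t e2) rfl
    refine ⟨atom M a * compl M a b * z3, ?_, ?_, fun w hxw hyw => ?_⟩
    · rw [mul_assoc, mul_dvd_mul_left_iff']
      exact hxz1.trans (mul_dvd_mul_left _ hs)
    · rw [atom_mul_compl_comm h0, mul_assoc, mul_dvd_mul_left_iff']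
      exact hyz2.trans (mul_dvd_mul_left _ ht)
    · obtain ⟨w1, hw1⟩ := (dvd_mul_right (atom M a) x).trans hxw
      obtain ⟨w2, hw2⟩ := (dvd_mul_right (atom M b) y).trans hyw
      have d1 := (compl_dvd hab (x := w1) ⟨w2, hw1.symm.trans hw2⟩).2
      have d2 := (compl_dvd (Ne.symm hab) (x := w2) ⟨w1, hw2.symm.trans hw1⟩).2
      rw [hw1, mul_dvd_mul_left_iff'] at hxw
      rw [hw2, mul_dvd_mul_left_iff'] at hyw
      have f1 : atom M a * compl M a b * s ∣ w := by
        rw [hw1, mul_assoc, mul_dvd_mul_left_iff']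
        exact hz1 _ hxw d1
      have f2 : atom M a * compl M a b * t ∣ w := by
        rw [atom_mul_compl_comm h0, hw2, mul_assoc, mul_dvd_mul_left_iff']
        exact hz2 _ hyw d2
      obtain ⟨w3, rfl⟩ := (dvd_mul_right _ _).trans f1
      rw [mul_dvd_mul_left_iff'] at *
      exact hz3 _ f1 f2

/-! ### Left divisibility by atoms -/

theorem ne_of_eq_two {s t : A} (h : M s t = 2) : s ≠ t := by
  rintro rfl
  rw [M.diagonal] at h
  omega

theorem eq_or_eq_two_or_adj (M : CoxeterMatrix A) (s t : A) :
    s = t ∨ M s t = 2 ∨ (coxeterGraph M).Adj s t := by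
  by_cases h : s = t
  · exact Or.inl h
  by_cases h2 : M s t = 2
  · exact Or.inr (Or.inl h2)
  · exact Or.inr (Or.inr ⟨h, h2⟩)

theorem atom_mul_comm {s t : A} (h : M s t = 2) : atom M s * atom M t = atom M t * atom M s := by
  have h1 := altProd_atom_comm M (a := s) (b := t) (by omega)
  simpa [h, altProd_succ, altProd_zero] using h1

theorem atom_mul_left_comm {s t : A} (h : M s t = 2) (x : ArtinTitsMonoid M) :
    atom M s * (atom M t * x) = atom M t * (atom M s * x) := by
  rw [← mul_assoc, atom_mul_comm h, mul_assoc]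

theorem atom_dvd_of_dvd_atom_mul {b t : A} (hbt : b ≠ t) {x : ArtinTitsMonoid M}
    (h : atom M t ∣ atom M b * x) : atom M t ∣ x := by
  obtain ⟨h0, h1⟩ := compl_dvd hbt h
  refine dvd_trans ?_ h1
  have := two_le_of_ne M hbt h0
  obtain ⟨k, hk⟩ : ∃ k, M b t - 1 = k + 1 := ⟨M b t - 2, by omega⟩
  rw [compl, hk, altProd_succ]
  exact dvd_mul_right _ _

theorem atom_mul_atom_dvd_of_adj {b t : A} (hbt : (coxeterGraph M).Adj b t) {x : ArtinTitsMonoid M}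
    (h : atom M t ∣ atom M b * x) : atom M t * atom M b ∣ x := by
  obtain ⟨h0, h1⟩ := compl_dvd hbt.1 h
  refine dvd_trans ?_ h1
  have := two_le_of_ne M hbt.1 h0
  have := hbt.2
  obtain ⟨k, hk⟩ : ∃ k, M b t - 1 = k + 1 + 1 := ⟨M b t - 3, by omega⟩
  rw [compl, hk, altProd_succ, altProd_succ, ← mul_assoc]
  exact dvd_mul_right _ _

/-- If `b * x` is a multiple of `t ≠ b`, so is `b * b * x`, because `b * lcm(b, t)` is a multiple of
`lcm(b, t)`. -/
theorem atom_dvd_sq_mul {b t : A} (hbt : b ≠ t) {x : ArtinTitsMonoid M}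
    (h : atom M t ∣ atom M b * x) : atom M t ∣ atom M b * (atom M b * x) := by
  obtain ⟨h0, y, rfl⟩ := compl_dvd hbt h
  have hm := two_le_of_ne M hbt h0
  obtain ⟨k, hk⟩ : ∃ k, M b t = k + 1 := ⟨M b t - 1, by omega⟩
  have h1 : compl M b t ∣ atom M b * (compl M b t * y) := by
    rw [← mul_assoc, atom_mul_compl h0, altProd_atom_comm M h0]
    refine dvd_mul_of_dvd_left ?_ y
    rw [compl, hk, Nat.add_sub_cancel, altProd_succ_right]
    exact dvd_mul_right _ _
  refine dvd_trans ?_ (mul_dvd_mul_left _ h1)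
  rw [atom_mul_compl_comm h0]
  exact dvd_mul_right _ _

/-- `x` avoids the letter `h`: the elements `x` and `h` have no common right multiple. -/
def Avoids (x : ArtinTitsMonoid M) (h : A) : Prop :=
  ∀ p, ¬ atom M h ∣ x * p

theorem Avoids.atom_mul {x : ArtinTitsMonoid M} {b h : A} (hx : Avoids x h) (hbh : b ≠ h) :
    Avoids (atom M b * x) h := by
  intro p hp
  rw [mul_assoc] at hp
  exact hx p (atom_dvd_of_dvd_atom_mul hbh hp)

theorem Avoids.sq_mul {x : ArtinTitsMonoid M} {b h : A} (hx : Avoids x h) (hbh : b ≠ h) :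
    Avoids (atom M b * (atom M b * x)) h :=
  (hx.atom_mul hbh).atom_mul hbh

/-- If `f * f * x` avoids a neighbour `e` of `f`, then multiplication by `e * e` makes the product avoid
`f` instead. -/
theorem Avoids.swap {x : ArtinTitsMonoid M} {e f : A} (hef : (coxeterGraph M).Adj e f)
    (hx : Avoids (atom M f * (atom M f * x)) e) :
    Avoids (atom M e * (atom M e * (atom M f * (atom M f * x)))) f := by
  intro p hp
  simp only [mul_assoc] at hp
  have h1 := atom_dvd_of_dvd_atom_mul hef.1 hp
  have h2 := atom_mul_atom_dvd_of_adj hef h1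
  rw [mul_dvd_mul_left_iff'] at h2
  refine hx p ?_
  simp only [mul_assoc]
  exact atom_dvd_sq_mul hef.1.symm h2

/-! ### Doubled words -/

/-- `x` begins, possibly after some letters that commute with `c`, with a letter `t` that does not
commute with `c`, followed by `c` itself. For elements `x` without this property, multiplication by `c * c`
controls the atoms that divide the product. -/
inductive Blocked (c : A) : ArtinTitsMonoid M → Prop
  | base {t : A} {x : ArtinTitsMonoid M} (ht : (coxeterGraph M).Adj t c)
      (h : atom M t * atom M c ∣ x) : Blocked c x
  | step {s : A} {x : ArtinTitsMonoid M} (hs : M s c = 2) (h : Blocked c x) :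
      Blocked c (atom M s * x)

theorem eq_or_of_atom_dvd {b t : A} {x : ArtinTitsMonoid M} (hb : ¬ Blocked b x)
    (h : atom M t ∣ atom M b * x) : t = b ∨ (M t b = 2 ∧ atom M t ∣ x) := by
  rcases eq_or_eq_two_or_adj M t b with h1 | h1 | h1
  · exact Or.inl h1
  · exact Or.inr ⟨h1, atom_dvd_of_dvd_atom_mul (ne_of_eq_two h1).symm h⟩
  · exact (hb (.base h1 (atom_mul_atom_dvd_of_adj h1.symm h))).elim

/-- A letter that commutes with `b` can be split off from `b * x`. -/
theorem exists_eq_of_atom_dvd {b t : A} {x : ArtinTitsMonoid M} (hb : ¬ Blocked b x) (htb : t ≠ b)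
    (h : atom M t ∣ atom M b * x) :
    M t b = 2 ∧ ∃ u, x = atom M t * u ∧ ¬ Blocked b u ∧
      atom M b * x = atom M t * (atom M b * u) := by
  obtain ⟨h1, u, rfl⟩ := (eq_or_of_atom_dvd hb h).resolve_left htb
  exact ⟨h1, u, rfl, fun hu => hb (.step h1 hu), (atom_mul_left_comm h1 u).symm⟩

theorem not_blocked_self_mul {b : A} {x : ArtinTitsMonoid M} (hb : ¬ Blocked b x) :
    ¬ Blocked b (atom M b * x) := by
  intro h
  generalize hy : atom M b * x = y at h
  induction h generalizing x with
  | base ht hd =>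
    subst hy
    obtain ⟨h1, -⟩ := exists_eq_of_atom_dvd hb ht.1 ((dvd_mul_right _ _).trans hd)
    exact ht.2 h1
  | step hs h ih =>
    obtain ⟨-, u, -, hu, he⟩ := exists_eq_of_atom_dvd hb (ne_of_eq_two hs)
      (hy ▸ dvd_mul_right _ _)
    exact ih hu (mul_left_cancel (he.symm.trans hy))

theorem not_blocked_mul_of_eq_two {b c : A} (hbc : M b c = 2) {x : ArtinTitsMonoid M}
    (hb : ¬ Blocked b x) (hc : ¬ Blocked c x) : ¬ Blocked c (atom M b * x) := by
  intro h
  generalize hy : atom M b * x = y at h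
  induction h generalizing x with
  | @base t y ht hd =>
    subst hy
    have htb : t ≠ b := by
      rintro rfl
      exact ht.2 hbc
    obtain ⟨-, u, rfl, hu, he⟩ := exists_eq_of_atom_dvd hb htb ((dvd_mul_right _ _).trans hd)
    rw [he, mul_dvd_mul_left_iff'] at hd
    refine hc (.base ht (mul_dvd_mul_left _ ?_))
    exact atom_dvd_of_dvd_atom_mul (ne_of_eq_two hbc) hd
  | @step s y hs h ih =>
    by_cases hsb : s = b
    · subst hsb
      exact hc ((mul_left_cancel hy).symm ▸ h)
    · obtain ⟨-, u, rfl, hu, he⟩ := exists_eq_of_atom_dvd hb hsb (hy ▸ dvd_mul_right _ _)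
      exact ih hu (fun hcu => hc (.step hs hcu)) (mul_left_cancel (he.symm.trans hy))

/-- Multiplication by the square of an unblocked letter unblocks its neighbours `c`. A single
factor `b` does not suffice: if `c` divides `x`, then `c` is blocked in `b * x`. -/
theorem not_blocked_sq_mul_of_adj {b c : A} (hbc : (coxeterGraph M).Adj b c)
    {x : ArtinTitsMonoid M} (hb : ¬ Blocked b x) :
    ¬ Blocked c (atom M b * (atom M b * x)) := by
  intro h
  generalize hy : atom M b * (atom M b * x) = y at h
  have hcb : M c b ≠ 2 := hbc.symm.2
  induction h generalizing x with
  | @base t y ht hd =>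
    subst hy
    by_cases htb : t = b
    · subst htb
      rw [mul_dvd_mul_left_iff'] at hd
      exact hcb (exists_eq_of_atom_dvd hb hbc.1.symm hd).1
    · have hb' := not_blocked_self_mul hb
      have hd1 := (dvd_mul_right _ _).trans hd
      obtain ⟨-, u', hu', -⟩ := exists_eq_of_atom_dvd hb' htb hd1
      obtain ⟨h1, u, rfl, hu, he⟩ := exists_eq_of_atom_dvd hb htb (hu' ▸ dvd_mul_right _ _)
      rw [he, ← atom_mul_left_comm h1, mul_dvd_mul_left_iff'] at hd
      obtain ⟨h2, -⟩ := exists_eq_of_atom_dvd (not_blocked_self_mul hu) hbc.1.symm hd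
      exact hcb h2
  | @step s y hs h ih =>
    have hsb : s ≠ b := by
      rintro rfl
      exact hbc.2 hs
    obtain ⟨-, u', hu', -⟩ := exists_eq_of_atom_dvd (not_blocked_self_mul hb) hsb
      (hy ▸ dvd_mul_right _ _)
    obtain ⟨h1, u, rfl, hu, he⟩ := exists_eq_of_atom_dvd hb hsb (hu' ▸ dvd_mul_right _ _)
    rw [he, ← atom_mul_left_comm h1] at hy
    exact ih hu (mul_left_cancel hy)

theorem not_blocked_sq_mul {b c : A} {x : ArtinTitsMonoid M} (hb : ¬ Blocked b x)
    (hc : ¬ Blocked c x) : ¬ Blocked c (atom M b * (atom M b * x)) := by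
  rcases eq_or_eq_two_or_adj M b c with rfl | h | h
  · exact not_blocked_self_mul (not_blocked_self_mul hb)
  · exact not_blocked_mul_of_eq_two h (not_blocked_self_mul hb)
      (not_blocked_mul_of_eq_two h hb hc)
  · exact not_blocked_sq_mul_of_adj h hb

theorem atom_dvd_sq_mul_cases {b t : A} {x : ArtinTitsMonoid M} (hb : ¬ Blocked b x)
    (h : atom M t ∣ atom M b * (atom M b * x)) : t = b ∨ (M t b = 2 ∧ atom M t ∣ x) := by
  rcases eq_or_of_atom_dvd (not_blocked_self_mul hb) h with h1 | ⟨-, h1⟩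
  · exact Or.inl h1
  · exact eq_or_of_atom_dvd hb h1

/-- The homomorphism to `(ℕ, ·)` that detects the letter `d`: its value is `0` on the elements in
which `d` occurs and `1` on all others. -/
noncomputable def letterHom (M : CoxeterMatrix A) (d : A) : ArtinTitsMonoid M →* ℕ :=
  open Classical in
  liftAtoms (fun a => if a = d then 0 else 1) fun a b h0 => by
    by_cases hab : a = b
    · rw [hab]
    obtain ⟨k, hk⟩ : ∃ k, M a b = k + 1 + 1 := ⟨M a b - 2, by
      have := two_le_of_ne M hab h0; omega⟩
    have hone : ∀ n, altProd (1 : ℕ) 1 n = 1 := by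
      intro n
      induction n with
      | zero => rfl
      | succ n ih => rw [altProd_succ, ih, one_mul]
    by_cases ha : a = d
    · rw [hk, altProd_succ, altProd_succ, altProd_succ, altProd_succ, if_pos ha]
      simp only [zero_mul, mul_zero]
    by_cases hb : b = d
    · rw [hk, altProd_succ, altProd_succ, altProd_succ, altProd_succ, if_pos hb]
      simp only [zero_mul, mul_zero]
    · simp only [ha, hb, if_false]

theorem letterHom_self (d : A) : letterHom M d (atom M d) = 0 := by
  rw [letterHom, liftAtoms_atom, if_pos rfl]

theorem letterHom_of_ne {a d : A} (h : a ≠ d) : letterHom M d (atom M a) = 1 := by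
  rw [letterHom, liftAtoms_atom, if_neg h]

theorem finite_letterHom_ne_one (x : ArtinTitsMonoid M) : {d | letterHom M d x ≠ 1}.Finite := by
  induction x using atom_induction with
  | one => simp
  | mul a x ih =>
    refine (ih.insert a).subset fun d hd => ?_
    by_cases hda : d = a
    · exact Or.inl hda
    · refine Or.inr fun h => hd ?_
      rw [map_mul, letterHom_of_ne (Ne.symm hda), h]

/-- No letter is blocked in an element in which it does not occur. -/
theorem not_blocked_of_letterHom {d : A} {x : ArtinTitsMonoid M} (h : letterHom M d x = 1) :
    ¬ Blocked d x := by
  have : ∀ y, Blocked d y → letterHom M d y = 0 := by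
    intro y hy
    induction hy with
    | base ht hd =>
      obtain ⟨u, rfl⟩ := hd
      rw [map_mul, map_mul, letterHom_self, mul_zero, zero_mul]
    | step hs h ih => rw [map_mul, ih, mul_zero]
  intro hb
  have := this x hb
  omega

/-! ### Moving the avoided letter along the Coxeter graph -/

/-- `x` avoids `h`, and neither `h` nor its neighbours are blocked in `x`, so that the avoided letter
can be moved to any neighbour by multiplying `x` from the left. -/
def Movable (x : ArtinTitsMonoid M) (h : A) : Prop :=
  Avoids x h ∧ ¬ Blocked h x ∧ ∀ c, (coxeterGraph M).Adj h c → ¬ Blocked c x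

theorem Movable.move {x : ArtinTitsMonoid M} {h c : A} (hx : Movable x h)
    (hc : (coxeterGraph M).Adj h c) :
    ∃ y : ArtinTitsMonoid M, Movable y c ∧ ∀ d, ¬ Blocked d x → ¬ Blocked d y := by
  obtain ⟨h1, h2, h3⟩ := hx
  have hcx := h3 c hc
  have key : ∀ d, ¬ Blocked d (atom M c * (atom M c * x)) →
      ¬ Blocked d (atom M h * (atom M h * (atom M c * (atom M c * x)))) := fun d hd =>
    not_blocked_sq_mul (not_blocked_sq_mul_of_adj hc.symm hcx) hd
  refine ⟨_, ⟨(h1.sq_mul hc.1.symm).swap hc, ?_, ?_⟩, fun d hd => key d (not_blocked_sq_mul hcx hd)⟩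
  · exact key c (not_blocked_sq_mul hcx hcx)
  · exact fun d hd => key d (not_blocked_sq_mul_of_adj hd hcx)

theorem Movable.exists_of_reachable {x : ArtinTitsMonoid M} {h c : A} (hx : Movable x h)
    (hc : (coxeterGraph M).Reachable h c) :
    ∃ y : ArtinTitsMonoid M, Movable y c ∧ ∀ d, ¬ Blocked d x → ¬ Blocked d y := by
  obtain ⟨p⟩ := hc
  induction p generalizing x with
  | nil => exact ⟨x, hx, fun d hd => hd⟩
  | cons hadj p ih =>
    obtain ⟨y, hy, hxy⟩ := hx.move hadj
    obtain ⟨z, hz, hyz⟩ := ih hy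
    exact ⟨z, hz, fun d hd => hyz d (hxy d hd)⟩

/-- Multiplying by the doubled letters of a path from `d` towards `g` unblocks a neighbour of `g`. -/
theorem exists_avoids_adj {x : ArtinTitsMonoid M} {d g : A} (hdg : d ≠ g)
    (hr : (coxeterGraph M).Reachable d g) (hd : ¬ Blocked d x) (hx : Avoids x g) :
    ∃ (y : ArtinTitsMonoid M) (p : A), (coxeterGraph M).Adj p g ∧ ¬ Blocked p y ∧ Avoids y g := by
  obtain ⟨w⟩ := hr
  induction w generalizing x with
  | nil => exact (hdg rfl).elim
  | @cons d d' g hadj w ih =>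
    by_cases h : d' = g
    · subst h
      exact ⟨x, d, hadj, hd, hx⟩
    · exact ih h (not_blocked_sq_mul_of_adj hadj hd) (hx.sq_mul hdg)

/-- If `z` avoids a letter `g`, then multiplication by doubled letters along a path from a letter
that does not occur in `z` to `g` gives a movable element. -/
theorem exists_movable [Infinite A] (hirr : IsIrreducible M) {z : ArtinTitsMonoid M} {g : A}
    (hz : Avoids z g) : ∃ (x : ArtinTitsMonoid M) (h : A), Movable x h := by
  obtain ⟨d, hd⟩ := ((finite_letterHom_ne_one z).insert g).exists_notMem
  rw [Set.mem_insert_iff, not_or, Set.mem_ofPred_eq, not_not] at hd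
  obtain ⟨y, p, hp, hpy, hy⟩ := exists_avoids_adj hd.1 (hirr.preconnected d g)
    (not_blocked_of_letterHom hd.2) hz
  have hg := not_blocked_sq_mul_of_adj hp hpy
  have key : ∀ c, ¬ Blocked c (atom M p * (atom M p * y)) →
      ¬ Blocked c (atom M g * (atom M g * (atom M p * (atom M p * y)))) :=
    fun c hc => not_blocked_sq_mul hg hc
  refine ⟨_, p, (hy.sq_mul hp.1).swap hp.symm, key p (not_blocked_sq_mul hpy hpy), fun c hc => ?_⟩
  exact key c (not_blocked_sq_mul_of_adj hc hpy)

theorem exists_movable_forall_not_blocked (hirr : IsIrreducible M) {x : ArtinTitsMonoid M} {h : A}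
    (hx : Movable x h) (a : A) {T : Set A} (hT : T.Finite) :
    ∃ y : ArtinTitsMonoid M, Movable y a ∧ ∀ t ∈ T, ¬ Blocked t y := by
  induction T, hT using Set.Finite.induction_on with
  | empty =>
    obtain ⟨y, hy, -⟩ := hx.exists_of_reachable (hirr.preconnected h a)
    exact ⟨y, hy, fun t ht => ht.elim⟩
  | @insert t T _ _ ih =>
    obtain ⟨y, hy, hyT⟩ := ih
    obtain ⟨y1, hy1, h1⟩ := hy.exists_of_reachable (hirr.preconnected a t)
    obtain ⟨y2, hy2, h2⟩ := hy1.exists_of_reachable (hirr.preconnected t a)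
    refine ⟨y2, hy2, fun s hs => ?_⟩
    rcases hs with rfl | hs
    · exact h2 _ hy1.2.1
    · exact h2 _ (h1 _ (hyT s hs))

/-! ### Doubled walks -/

/-- The product of the doubled letters of a word, times `x`. -/
def doubledMul (M : CoxeterMatrix A) (l : List A) (x : ArtinTitsMonoid M) : ArtinTitsMonoid M :=
  l.foldr (fun b y => atom M b * (atom M b * y)) x

theorem doubledMul_cons (b : A) (l : List A) (x : ArtinTitsMonoid M) :
    doubledMul M (b :: l) x = atom M b * (atom M b * doubledMul M l x) := rfl

theorem not_blocked_doubledMul {l : List A} {x : ArtinTitsMonoid M} (hl : ∀ b ∈ l, ¬ Blocked b x)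
    {c : A} (hc : ¬ Blocked c x) : ¬ Blocked c (doubledMul M l x) := by
  induction l generalizing c with
  | nil => exact hc
  | cons b l ih =>
    have hl' : ∀ b ∈ l, ¬ Blocked b x := fun b hb => hl b (List.mem_cons_of_mem _ hb)
    exact not_blocked_sq_mul (ih hl' (hl b List.mem_cons_self)) (ih hl' hc)

/-- A doubled walk can be divided only by its first letter and by letters that commute with all
letters of the walk. -/
theorem atom_dvd_doubledMul_support {e z : A} (w : (coxeterGraph M).Walk e z)
    {x : ArtinTitsMonoid M} (hx : ∀ b ∈ w.support, ¬ Blocked b x) {t : A}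
    (ht : atom M t ∣ doubledMul M w.support x) : t = e ∨ ∀ b ∈ w.support, M t b = 2 := by
  induction w with
  | nil =>
    rcases atom_dvd_sq_mul_cases (hx _ (by simp)) ht with h | ⟨h, -⟩
    · exact Or.inl h
    · exact Or.inr (by simpa using h)
  | @cons e e' z hadj w ih =>
    have hx' : ∀ b ∈ w.support, ¬ Blocked b x := fun b hb => hx b (by simp [hb])
    rw [SimpleGraph.Walk.support_cons, doubledMul_cons] at ht
    rcases atom_dvd_sq_mul_cases (not_blocked_doubledMul hx' (hx e (by simp))) ht with h | ⟨h, hd⟩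
    · exact Or.inl h
    · right
      rcases ih hx' hd with rfl | h'
      · exact (hadj.symm.2 h).elim
      · simpa [SimpleGraph.Walk.support_cons, h] using h'

/-- The letter that a doubled walk avoids depends only on the letter that the second factor avoids:
whenever the walk meets the avoided letter, the latter steps back to the preceding letter of the
walk. -/
theorem exists_forall_avoids_doubledMul {e z : A} (w : (coxeterGraph M).Walk e z) {a : A}
    (ha : a ≠ e) : ∃ f, ∀ x, Avoids x f → Avoids (doubledMul M w.support x) a := by
  induction w generalizing a with
  | nil => exact ⟨a, fun x hx => hx.sq_mul ha.symm⟩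
  | @cons e e' z hadj w ih =>
    by_cases h : a = e'
    · subst h
      obtain ⟨f, hf⟩ := ih hadj.1
      refine ⟨f, fun x hx => ?_⟩
      have h1 := hf x hx
      rw [SimpleGraph.Walk.support_cons, doubledMul_cons]
      rw [← SimpleGraph.Walk.cons_tail_support w, doubledMul_cons] at h1 ⊢
      exact h1.swap hadj
    · obtain ⟨f, hf⟩ := ih h
      exact ⟨f, fun x hx => (hf x hx).sq_mul ha.symm⟩

theorem exists_walk_support (hirr : IsIrreducible M) (e : A) {T : Set A} (hT : T.Finite) :
    ∃ z, ∃ w : (coxeterGraph M).Walk e z, ∀ t ∈ T, t ∈ w.support := by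
  induction T, hT using Set.Finite.induction_on with
  | empty => exact ⟨e, .nil, fun t ht => ht.elim⟩
  | @insert t T _ _ ih =>
    obtain ⟨z, w, hw⟩ := ih
    obtain ⟨w'⟩ := hirr.preconnected z t
    refine ⟨t, w.append w', fun s hs => ?_⟩
    rw [SimpleGraph.Walk.mem_support_append_iff]
    rcases hs with rfl | hs
    · exact Or.inr w'.end_mem_support
    · exact Or.inl (hw s hs)

theorem exists_adj [Infinite A] (hirr : IsIrreducible M) (t : A) :
    ∃ c, (coxeterGraph M).Adj t c := by
  obtain ⟨d, hd⟩ := exists_ne t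
  obtain ⟨w⟩ := hirr.preconnected t d
  cases w with
  | nil => exact (hd rfl).elim
  | cons h _ => exact ⟨_, h⟩

/-- Some element avoids `a` and is divisible by none of finitely many prescribed atoms: a doubled
walk that starts outside these letters and meets a neighbour of each of them. -/
theorem exists_avoids_not_dvd [Infinite A] (hirr : IsIrreducible M) {z : ArtinTitsMonoid M} {g : A}
    (hz : Avoids z g) (a : A) {T : Set A} (hT : T.Finite) :
    ∃ y : ArtinTitsMonoid M, Avoids y a ∧ ∀ t ∈ T, ¬ atom M t ∣ y := by
  obtain ⟨x0, h, hx0⟩ := exists_movable hirr hz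
  obtain ⟨e, he⟩ := (hT.insert a).exists_notMem
  rw [Set.mem_insert_iff, not_or] at he
  choose n hn using exists_adj hirr
  obtain ⟨z', w, hw⟩ := exists_walk_support hirr e (hT.image n)
  obtain ⟨f, hf⟩ := exists_forall_avoids_doubledMul w (Ne.symm he.1)
  obtain ⟨x, hx, hxw⟩ := exists_movable_forall_not_blocked hirr hx0 f w.support.finite_toSet
  refine ⟨doubledMul M w.support x, hf x hx.1, fun t ht hd => ?_⟩
  rcases atom_dvd_doubledMul_support w hxw hd with rfl | h2
  · exact he.2 ht
  · exact (hn t).2 (h2 _ (hw _ (Set.mem_image_of_mem n ht)))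

/-- If `t` does not divide `x`, then `x * y` can become a multiple of `t` only if `y` is a multiple of a
fixed atom, namely of one that divides `x⁻¹ lcm(x, t)`. -/
theorem exists_atom_dvd_of_mul_dvd (x : ArtinTitsMonoid M) {t : A} (ht : ¬ atom M t ∣ x) :
    ∃ f, ∀ y, atom M t ∣ x * y → atom M f ∣ y := by
  by_cases hc : ∃ m, x ∣ m ∧ atom M t ∣ m
  · obtain ⟨m, hxm, htm⟩ := hc
    obtain ⟨_, ⟨r, rfl⟩, htr, hr⟩ := exists_isLcm hxm htm
    rcases eq_one_or_exists_atom_mul r with rfl | ⟨f, r, rfl⟩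
    · rw [mul_one] at htr
      exact (ht htr).elim
    · refine ⟨f, fun y hy => ?_⟩
      have := hr _ (dvd_mul_right x y) hy
      rw [mul_dvd_mul_left_iff'] at this
      exact (dvd_mul_right _ _).trans this
  · exact ⟨t, fun y hy => (hc ⟨_, dvd_mul_right x y, hy⟩).elim⟩

/-- Some element avoids finitely many prescribed letters: they are removed one by one, and at each
step none of them becomes a divisor. -/
theorem exists_forall_avoids [Infinite A] (hirr : IsIrreducible M) {z : ArtinTitsMonoid M} {g : A}
    (hz : Avoids z g) {F : Set A} (hF : F.Finite) :
    ∃ x : ArtinTitsMonoid M, ∀ a ∈ F, Avoids x a := by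
  have key : ∀ S : Set A, S.Finite → S ⊆ F →
      ∃ x : ArtinTitsMonoid M, (∀ a ∈ S, Avoids x a) ∧ ∀ t ∈ F, ¬ atom M t ∣ x := by
    intro S hS
    induction S, hS using Set.Finite.induction_on with
    | empty => exact fun _ => ⟨1, fun a ha => ha.elim, fun t _ => not_atom_dvd_one t⟩
    | @insert a S _ _ ih =>
      intro hSF
      obtain ⟨x, hx, hxF⟩ := ih fun s hs => hSF (Set.mem_insert_of_mem _ hs)
      choose! f hf using fun t (ht : t ∈ F) => exists_atom_dvd_of_mul_dvd x (hxF t ht)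
      obtain ⟨y, hy, hyF⟩ := exists_avoids_not_dvd hirr hz (f a) (hF.image f)
      refine ⟨x * y, fun s hs p hp => ?_, fun t ht hd => ?_⟩
      · rw [mul_assoc] at hp
        rcases hs with rfl | hs
        · exact hy p (hf _ (hSF (Set.mem_insert _ _)) _ hp)
        · exact hx s hs _ hp
      · exact hyF _ (Set.mem_image_of_mem f ht) (hf t ht _ hd)
  obtain ⟨x, hx, -⟩ := key F hF subset_rfl
  exact ⟨x, hx⟩

theorem exists_avoids_of_not_isLeftReversible (h : ¬ IsLeftReversible (ArtinTitsMonoid M)) :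
    ∃ (z : ArtinTitsMonoid M) (g : A), Avoids z g := by
  by_contra hcon
  push Not at hcon
  refine h fun p => ?_
  induction p using atom_induction with
  | one => exact fun q => ⟨q, ⟨q, one_mul q⟩, ⟨1, mul_one q⟩⟩
  | mul a p ih =>
    intro q
    have h1 := hcon q a
    simp only [Avoids, not_forall, not_not] at h1
    obtain ⟨u, v, huv⟩ := h1
    obtain ⟨_, ⟨r, rfl⟩, ⟨s, hs⟩⟩ := ih v
    refine ⟨atom M a * (p * r), ⟨r, mul_assoc _ _ _⟩, ⟨u * s, ?_⟩⟩
    dsimp only at hs ⊢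
    rw [← hs, ← mul_assoc, huv, mul_assoc]

theorem infinite_of_not_fg (h : ¬ Monoid.FG (ArtinTitsMonoid M)) : Infinite A := by
  by_contra hcon
  rw [not_infinite_iff_finite] at hcon
  refine h ((Submonoid.fg_iff _).2 ⟨_, PresentedMonoid.closure_range_of (BraidRel M),
    Set.finite_range _⟩ |> Monoid.fg_def.2)

end ArtinTits

namespace InvHull

open ArtinTits

/-! ### The left inverse hull of a right LCM monoid -/

section

variable {P : Type*} [Monoid P] [IsLeftCancelMul P]

open Classical in
/-- The left translation by `c` as a partial bijection. -/
noncomputable def translation (c : P) : P ≃. P where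
  toFun x := some (c * x)
  invFun y := if h : ∃ x, c * x = y then some h.choose else none
  inv x y := by
    simp only [Option.some.injEq]
    constructor
    · intro h
      split_ifs at h with hy
      rw [← Option.some.inj h, hy.choose_spec]
    · rintro rfl
      have h : ∃ x', c * x' = c * x := ⟨x, rfl⟩
      rw [dif_pos h, mul_left_cancel h.choose_spec]

theorem translation_apply (c x : P) : translation c x = some (c * x) := rfl

/-- The left translation by `c` as an element of the left inverse hull. -/
noncomputable def translationHull (c : P) : Hull P :=
  ⟨translation c, .of c _ (translation_apply c)⟩

/-- The principal right ideal generated by `q`. -/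
noncomputable def principal (q : P) : ConsIdeal P :=
  ⟨{x | q ∣ x}, (translation q).symm, .symm _ (translationHull q).2, by
    ext x
    constructor
    · rintro ⟨y, rfl⟩
      exact ⟨y, (PEquiv.eq_some_iff _).2 (translation_apply q y)⟩
    · rintro ⟨y, hy⟩
      exact ⟨y, (Option.some.inj ((PEquiv.eq_some_iff _).1 hy)).symm⟩⟩

theorem mem_principal {q x : P} : x ∈ (principal q).1 ↔ q ∣ x := Iff.rfl

/-- In a right LCM monoid a non-empty element of the left inverse hull has the form
`q * z ↦ p * z`. -/
theorem IsZigzag.eq_empty_or_exists (hlcm : ∀ x y m : P, x ∣ m → y ∣ m → ∃ z, IsLcm x y z)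
    {s : P ≃. P} (hs : IsZigzag s) :
    (∀ x y, s x ≠ some y) ∨ ∃ p q, ∀ x y, s x = some y ↔ ∃ z, x = q * z ∧ y = p * z := by
  induction hs with
  | of c s hs =>
    refine Or.inr ⟨c, 1, fun x y => ?_⟩
    rw [hs, Option.some.injEq]
    exact ⟨fun h => ⟨x, (one_mul x).symm, h.symm⟩, by rintro ⟨z, rfl, rfl⟩; rw [one_mul]⟩
  | symm s _ ih =>
    rcases ih with h | ⟨p, q, h⟩
    · exact Or.inl fun x y hxy => h y x ((PEquiv.eq_some_iff s).1 hxy)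
    · refine Or.inr ⟨q, p, fun x y => ?_⟩
      rw [PEquiv.eq_some_iff, h]
      exact ⟨fun ⟨z, h1, h2⟩ => ⟨z, h2, h1⟩, fun ⟨z, h1, h2⟩ => ⟨z, h2, h1⟩⟩
  | trans s t _ _ ihs iht =>
    rcases ihs with hs | ⟨p, q, hs⟩
    · refine Or.inl fun x z h => ?_
      obtain ⟨y, hy, -⟩ := (trans_eq_some s t x z).1 h
      exact hs _ _ hy
    rcases iht with ht | ⟨p', q', ht⟩
    · refine Or.inl fun x z h => ?_
      obtain ⟨y, -, hy⟩ := (trans_eq_some s t x z).1 h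
      exact ht _ _ hy
    have key : ∀ x z, (s.trans t) x = some z ↔ ∃ u v, x = q * u ∧ p * u = q' * v ∧ z = p' * v := by
      intro x z
      rw [trans_eq_some]
      constructor
      · rintro ⟨y, h1, h2⟩
        obtain ⟨u, hu, rfl⟩ := (hs _ _).1 h1
        obtain ⟨v, hv, rfl⟩ := (ht _ _).1 h2
        exact ⟨u, v, hu, hv, rfl⟩
      · rintro ⟨u, v, rfl, h, rfl⟩
        exact ⟨p * u, (hs _ _).2 ⟨u, rfl, rfl⟩, (ht _ _).2 ⟨v, h, rfl⟩⟩
    by_cases hc : ∃ m, p ∣ m ∧ q' ∣ m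
    · obtain ⟨m, hpm, hqm⟩ := hc
      obtain ⟨_, ⟨u, rfl⟩, ⟨v, hv⟩, hmin⟩ := hlcm _ _ _ hpm hqm
      refine Or.inr ⟨p' * v, q * u, fun x z => ?_⟩
      rw [key]
      constructor
      · rintro ⟨u', v', rfl, h, rfl⟩
        obtain ⟨w, hw⟩ := hmin (p * u') (dvd_mul_right _ _) (h ▸ dvd_mul_right _ _)
        have hu' : u' = u * w := by
          rw [mul_assoc] at hw
          exact mul_left_cancel hw
        have hv' : v' = v * w := by
          rw [h, hv, mul_assoc] at hw
          exact mul_left_cancel hw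
        exact ⟨w, by rw [hu', mul_assoc], by rw [hv', mul_assoc]⟩
      · rintro ⟨w, rfl, rfl⟩
        exact ⟨u * w, v * w, mul_assoc _ _ _, by rw [← mul_assoc, hv, mul_assoc], mul_assoc _ _ _⟩
    · refine Or.inl fun x z h => hc ?_
      obtain ⟨u, v, -, h, -⟩ := (key x z).1 h
      exact ⟨p * u, dvd_mul_right _ _, h ▸ dvd_mul_right _ _⟩

/-- Every non-empty constructible right ideal of a right LCM monoid is principal. -/
theorem ConsIdeal.exists_eq_principal (hlcm : ∀ x y m : P, x ∣ m → y ∣ m → ∃ z, IsLcm x y z)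
    (e : ConsIdeal P) (he : e.1.Nonempty) : ∃ q, e = principal q := by
  obtain ⟨s, hs, hes⟩ := e.2
  rcases hs.eq_empty_or_exists hlcm with h | ⟨p, q, h⟩
  · obtain ⟨x, hx⟩ := he
    rw [hes] at hx
    obtain ⟨y, hy⟩ := hx
    exact (h _ _ hy).elim
  · refine ⟨q, Subtype.ext ?_⟩
    rw [hes]
    ext x
    rw [mem_principal]
    constructor
    · rintro ⟨y, hy⟩
      obtain ⟨z, hz, -⟩ := (h _ _).1 hy
      exact ⟨z, hz⟩
    · rintro ⟨z, rfl⟩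
      exact ⟨p * z, (h _ _).2 ⟨z, rfl, rfl⟩⟩

end

/-! ### Characters -/

section

variable {P : Type*} [Monoid P]

theorem Character.map_mul (χ : Character P) (e f : ConsIdeal P) :
    χ.1 (e * f) = (χ.1 e && χ.1 f) := χ.2.2.1 e f

theorem Character.nonempty (χ : Character P) {e : ConsIdeal P} (he : χ.1 e = true) :
    e.1.Nonempty := by
  rw [Set.nonempty_iff_ne_empty]
  intro h
  rw [χ.2.2.2 e h] at he
  exact Bool.false_ne_true he

theorem Character.mono (χ : Character P) {e f : ConsIdeal P} (hef : e.1 ⊆ f.1)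
    (he : χ.1 e = true) : χ.1 f = true := by
  have h : e * f = e := Subtype.ext (by rw [coe_mul, Set.inter_eq_left.2 hef])
  rw [← h, χ.map_mul, Bool.and_eq_true] at he
  exact he.2

open Classical in
/-- The character of all constructible ideals that contain `p`. -/
noncomputable def evalCharacter (p : P) : Character P :=
  ⟨fun e => decide (p ∈ e.1), ⟨dom ⟨PEquiv.refl P, isZigzag_refl P⟩, by simp [dom, domSet]⟩,
    fun e f => by simp [coe_mul, Bool.decide_and], fun e he => by simp [he]⟩

/-- Every character is dominated by a maximal one. -/
theorem exists_isMaxCharacter (χ : Character P) :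
    ∃ ψ : Character P, IsMaxCharacter ψ ∧ ∀ e, χ.1 e = true → ψ.1 e = true := by
  classical
  let S : Set (Set (ConsIdeal P)) := Set.range fun χ : Character P => {e | χ.1 e = true}
  have hchain : ∀ c ⊆ S, IsChain (· ⊆ ·) c → c.Nonempty → ∃ ub ∈ S, ∀ s ∈ c, s ⊆ ub := by
    intro c hcS hc ⟨s0, hs0⟩
    refine ⟨⋃₀ c, ⟨⟨fun e => decide (e ∈ ⋃₀ c), ?_, ?_, ?_⟩, Set.ext fun e => by simp⟩,
      fun s hs => Set.subset_sUnion_of_mem hs⟩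
    · obtain ⟨φ, hφ⟩ := hcS hs0
      obtain ⟨e, he⟩ := φ.2.1
      exact ⟨e, by simpa using ⟨s0, hs0, hφ ▸ he⟩⟩
    · intro e f
      rw [← Bool.decide_and, decide_eq_decide]
      constructor
      · rintro ⟨s, hs, hef⟩
        obtain ⟨φ, rfl⟩ := hcS hs
        change φ.1 (e * f) = true at hef
        rw [φ.map_mul, Bool.and_eq_true] at hef
        exact ⟨⟨_, hs, hef.1⟩, ⟨_, hs, hef.2⟩⟩
      · rintro ⟨⟨s, hs, he⟩, ⟨t, ht, hf⟩⟩
        obtain ⟨u, hu, hsu, htu⟩ : ∃ u ∈ c, s ⊆ u ∧ t ⊆ u := by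
          rcases hc.total hs ht with h | h
          · exact ⟨t, ht, h, subset_rfl⟩
          · exact ⟨s, hs, subset_rfl, h⟩
        obtain ⟨φ, rfl⟩ := hcS hu
        refine ⟨_, hu, ?_⟩
        change φ.1 (e * f) = true
        rw [φ.map_mul, Bool.and_eq_true]
        exact ⟨hsu he, htu hf⟩
    · intro e he
      rw [decide_eq_false_iff_not]
      rintro ⟨s, hs, hes⟩
      obtain ⟨φ, rfl⟩ := hcS hs
      exact (φ.nonempty hes).ne_empty he
  obtain ⟨m, hχm, ⟨ψ, rfl⟩, hmax⟩ := zorn_subset_nonempty S hchain _ ⟨χ, rfl⟩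
  refine ⟨ψ, fun φ hφ => ?_, fun e he => hχm he⟩
  have h := hφ.antisymm (hmax ⟨φ, rfl⟩ hφ)
  refine Subtype.ext (funext fun e => ?_)
  rw [Bool.eq_iff_iff]
  exact (Set.ext_iff.1 h e).symm

theorem Omega.exists_finset_of_isOpen {U : Set (Omega P)} (hU : IsOpen U) {χ : Omega P}
    (hχ : χ ∈ U) : ∃ I : Finset (ConsIdeal P), ∀ ψ : Omega P,
      (∀ e ∈ I, ψ.1.1 e = χ.1.1 e) → ψ ∈ U := by
  obtain ⟨V, hV, rfl⟩ := isOpen_induced_iff.1 hU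
  obtain ⟨V', hV', rfl⟩ := isOpen_induced_iff.1 hV
  obtain ⟨I, u, hu, hIu⟩ := isOpen_pi_iff.1 hV' _ hχ
  refine ⟨I, fun ψ hψ => hIu fun e he => ?_⟩
  rw [hψ e he]
  exact (hu e he).2

variable [IsLeftCancelMul P]

theorem Character.map_principal_one (χ : Character P) : χ.1 (principal 1) = true := by
  obtain ⟨e, he⟩ := χ.2.1
  exact χ.mono (fun x _ => mem_principal.2 (one_dvd x)) he

/-- In a right LCM monoid all characters belong to `Ω`: a principal right ideal that is a union of
constructible ideals is equal to the one that contains its generator. -/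
theorem Character.mem_omega (hlcm : ∀ x y m : P, x ∣ m → y ∣ m → ∃ z, IsLcm x y z)
    (χ : Character P) (e : ConsIdeal P) (F : Finset (ConsIdeal P)) (he : e.1 = ⋃ f ∈ F, f.1)
    (h : χ.1 e = true) : ∃ f ∈ F, χ.1 f = true := by
  obtain ⟨q, rfl⟩ := e.exists_eq_principal hlcm (χ.nonempty h)
  have hq : q ∈ (principal q).1 := mem_principal.2 dvd_rfl
  rw [he] at hq
  simp only [Set.mem_iUnion, exists_prop] at hq
  obtain ⟨f, hf, hqf⟩ := hq
  obtain ⟨r, rfl⟩ := f.exists_eq_principal hlcm ⟨q, hqf⟩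
  exact ⟨_, hf, χ.mono (fun x hx => (mem_principal.1 hqf).trans (mem_principal.1 hx)) h⟩

/-- If finitely many elements `≠ 1` can always be avoided simultaneously by some `x`, then every
neighbourhood in `Ω` contains the set of all characters with value `1` at some principal ideal. -/
theorem exists_forall_mem_of_map_principal
    (hlcm : ∀ x y m : P, x ∣ m → y ∣ m → ∃ z, IsLcm x y z)
    (havoid : ∀ R : Set P, R.Finite → 1 ∉ R → ∃ x : P, ∀ r ∈ R, ∀ z, x ∣ z → ¬ r ∣ z)
    {U : Set (Omega P)} (hU : IsOpen U) {χ : Omega P} (hχ : χ ∈ U) :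
    ∃ w : P, ∀ ψ : Omega P, ψ.1.1 (principal w) = true → ψ ∈ U := by
  classical
  obtain ⟨I, hI⟩ := Omega.exists_finset_of_isOpen hU hχ
  obtain ⟨q, hq, hqI⟩ : ∃ q, χ.1.1 (principal q) = true ∧
      ∀ e ∈ I, χ.1.1 e = true → (principal q).1 ⊆ e.1 := by
    clear hI
    induction I using Finset.induction_on with
    | empty => exact ⟨1, χ.1.map_principal_one, by simp⟩
    | insert e I _ ih =>
      obtain ⟨q, hq, hqI⟩ := ih
      by_cases he : χ.1.1 e = true
      · have h : χ.1.1 (e * principal q) = true := by rw [χ.1.map_mul, he, hq]; rfl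
        obtain ⟨q', hq'⟩ := (e * principal q).exists_eq_principal hlcm (χ.1.nonempty h)
        have hsub : (principal q').1 = e.1 ∩ (principal q).1 := by rw [← hq', coe_mul]
        refine ⟨q', hq' ▸ h, fun f hf hχf => ?_⟩
        rcases Finset.mem_insert.1 hf with rfl | hf
        · exact hsub ▸ Set.inter_subset_left
        · exact (hsub ▸ Set.inter_subset_right).trans (hqI f hf hχf)
      · refine ⟨q, hq, fun f hf hχf => ?_⟩
        rcases Finset.mem_insert.1 hf with rfl | hf
        · exact (he hχf).elim
        · exact hqI f hf hχf
  -- Here `r = 1` encodes that `f` and `qP` are disjoint.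
  have hr : ∀ f : ConsIdeal P, ∃ r : P, χ.1.1 f ≠ true →
      ∀ z ∈ f.1, q ∣ z → r ≠ 1 ∧ q * r ∣ z := by
    intro f
    by_cases hne : (f * principal q).1.Nonempty
    · obtain ⟨s, hs⟩ := (f * principal q).exists_eq_principal hlcm hne
      have hsub : (principal s).1 = f.1 ∩ (principal q).1 := by rw [← hs, coe_mul]
      have hsq : s ∈ f.1 ∩ (principal q).1 := hsub ▸ mem_principal.2 dvd_rfl
      obtain ⟨r, rfl⟩ := mem_principal.1 hsq.2
      refine ⟨r, fun hf z hzf hqz => ⟨?_, ?_⟩⟩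
      · rintro rfl
        rw [mul_one] at hs
        rw [← hs, χ.1.map_mul, Bool.and_eq_true] at hq
        exact hf hq.1
      · rw [← mem_principal, hsub]
        exact ⟨hzf, hqz⟩
    · exact ⟨1, fun _ z hzf hqz => (hne ⟨z, hzf, hqz⟩).elim⟩
  choose r hr using hr
  obtain ⟨x, hx⟩ := havoid ((r '' (I : Set (ConsIdeal P))) \ {1})
    ((I.finite_toSet.image r).subset Set.sdiff_subset) (fun h => h.2 rfl)
  refine ⟨q * x, fun ψ hψ => hI ψ fun e he => ?_⟩
  by_cases hχe : χ.1.1 e = true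
  · rw [hχe]
    exact ψ.1.mono (fun z hz => hqI e he hχe ((dvd_mul_right q x).trans (mem_principal.1 hz))) hψ
  · rw [Bool.eq_false_of_not_eq_true hχe, ← Bool.not_eq_true]
    intro hψe
    have h : ψ.1.1 (e * principal (q * x)) = true := by rw [ψ.1.map_mul, hψe, hψ]; rfl
    obtain ⟨z, hze, hz⟩ := ψ.1.nonempty h
    rw [mem_principal] at hz
    obtain ⟨hr1, hrz⟩ := hr e hχe z hze ((dvd_mul_right q x).trans hz)
    obtain ⟨y, rfl⟩ := hz
    obtain ⟨y', hy'⟩ := hrz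
    rw [mul_assoc, mul_assoc] at hy'
    exact hx (r e) ⟨Set.mem_image_of_mem r he, hr1⟩ _ (dvd_mul_right x y)
      ⟨y', mul_left_cancel hy'⟩

theorem boundary_eq_univ (hlcm : ∀ x y m : P, x ∣ m → y ∣ m → ∃ z, IsLcm x y z)
    (havoid : ∀ R : Set P, R.Finite → 1 ∉ R → ∃ x : P, ∀ r ∈ R, ∀ z, x ∣ z → ¬ r ∣ z) :
    boundary P = Set.univ := by
  refine Set.eq_univ_of_forall fun χ => mem_closure_iff.2 fun U hU hχ => ?_
  obtain ⟨w, hw⟩ := exists_forall_mem_of_map_principal hlcm havoid hU hχ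
  obtain ⟨ψ, hψ, hle⟩ := exists_isMaxCharacter (evalCharacter w)
  refine ⟨⟨ψ, ψ.mem_omega hlcm⟩, hw _ (hle _ ?_), hψ⟩
  simp [evalCharacter, mem_principal]

theorem isMinimalGroupoid_omega (hlcm : ∀ x y m : P, x ∣ m → y ∣ m → ∃ z, IsLcm x y z)
    (havoid : ∀ R : Set P, R.Finite → 1 ∉ R → ∃ x : P, ∀ r ∈ R, ∀ z, x ∣ z → ¬ r ∣ z) :
    IsMinimalGroupoid (Omega P) := by
  intro χ ψ
  refine mem_closure_iff.2 fun U hU hψ => ?_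
  obtain ⟨w, hw⟩ := exists_forall_mem_of_map_principal hlcm havoid hU hψ
  -- The left translation by `w` moves `χ` to a character with value `1` at `wP`.
  have hdom : χ.1.1 (dom (translationHull w)) = true :=
    χ.1.mono (fun x _ => ⟨w * x, rfl⟩) χ.1.map_principal_one
  refine ⟨act (translationHull w) χ hdom, hw _ ?_, ⟨Quotient.mk _ ⟨translationHull w, hdom, rfl⟩⟩⟩
  exact χ.1.mono (fun x _ => ⟨w * x, rfl, dvd_mul_right w x⟩) χ.1.map_principal_one

end

end InvHull

theorem mainTheorem11 {A : Type*} (M : CoxeterMatrix A)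
    (hirr : ArtinTits.IsIrreducible M)
    (hfg : ¬ Monoid.FG (ArtinTits.ArtinTitsMonoid M))
    (hrev : ¬ IsLeftReversible (ArtinTits.ArtinTitsMonoid M)) :
    InvHull.boundary (ArtinTits.ArtinTitsMonoid M) = Set.univ ∧
      IsMinimalGroupoid (InvHull.Omega (ArtinTits.ArtinTitsMonoid M)) := by
  have hlcm : ∀ x y m : ArtinTits.ArtinTitsMonoid M, x ∣ m → y ∣ m → ∃ z, ArtinTits.IsLcm x y z :=
    fun _ _ _ => ArtinTits.exists_isLcm
  have hinf := ArtinTits.infinite_of_not_fg hfg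
  obtain ⟨z, g, hz⟩ := ArtinTits.exists_avoids_of_not_isLeftReversible hrev
  have havoid : ∀ R : Set (ArtinTits.ArtinTitsMonoid M), R.Finite → 1 ∉ R →
      ∃ x : ArtinTits.ArtinTitsMonoid M, ∀ r ∈ R, ∀ z, x ∣ z → ¬ r ∣ z := by
    intro R hR h1
    have hletter : ∀ r ∈ R, ∃ a, ArtinTits.atom M a ∣ r := by
      intro r hr
      rcases ArtinTits.eq_one_or_exists_atom_mul r with rfl | ⟨a, q, rfl⟩
      · exact (h1 hr).elim
      · exact ⟨a, dvd_mul_right _ _⟩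
    have : Nonempty A := hirr.nonempty
    choose! f hf using hletter
    obtain ⟨x, hx⟩ := ArtinTits.exists_forall_avoids hirr hz (hR.image f)
    refine ⟨x, fun r hr z hxz hrz => ?_⟩
    obtain ⟨p, rfl⟩ := hxz
    exact hx _ (Set.mem_image_of_mem f hr) p ((hf r hr).trans hrz)
  exact ⟨InvHull.boundary_eq_univ hlcm havoid, InvHull.isMinimalGroupoid_omega hlcm havoid⟩
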